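/- **Compactness under linear growth.** *Setting.* Let $V$ be a finite set, $\mathcal X=\mathbb Z^d\times V$, and let $\mathcal E\subseteq\mathcal X\times\mathcal X$ be a symmetric, $\mathbb Z^d$-periodic set of edges such that $(\mathcal X,\mathcal E)$ is connected, locally finite and of bounded degree. For $x=(z,v)$ write $x_{\mathsf z}=z$, and let $R_0=\max_{(x,y)\in\mathcal E}|x_{\mathsf z}-y_{\mathsf z}|_\infty$. Let $\mathbb R_a^{\mathcal E}$ denote the antisymmetric functions on $\mathcal E$. Let $F:\mathbb R_+^{\mathcal X}\times\mathbb R_a^{\mathcal E}\to\mathbb R\cup\{+\infty\}$ be an admissible cost function, that is: (a) $F$ is convex and lower semicontinuous; (b) there is $R_1<\infty$ such that $F(m,J)$ depends only on the values $m(x)$ and $J(x,y)$ with $|x_{\mathsf z}|_\infty,|y_{\mathsf z}|_\infty\le R_1$; (c) there are $c>0$, $C<\infty$ such that, with $R=\max\{R_0,R_1\}$, for all $(m,J)$, $$F(m,J)\ \ge\ c\sum_{(x,y)\in\mathcal E,\ x_{\mathsf z}=0}|J(x,y)|-C\Big(1+\sum_{x\in\mathcal X,\ |x_{\mathsf z}|_\infty\le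 R}m(x)\Big);$$ (d) the interior of $\{F<\infty\}$ contains a pair $(m^\circ,J^\circ)$ with $m^\circ,J^\circ$ $\mathbb Z^d$-periodic and $J^\circ$ divergence-free. For $\varepsilon>0$ with $1/\varepsilon\in\mathbb N$ and $\varepsilon R_0<\frac12$ let $(\mathcal X_\varepsilon,\mathcal E_\varepsilon)$ be the graph obtained by rescaling $(\mathcal X,\mathcal E)$ by $\varepsilon$ and wrapping it around the torus: $\mathcal X_\varepsilon=(\varepsilon\mathbb Z/\mathbb Z)^d\times V$, and $\mathcal E_\varepsilon$ is the image of $\mathcal E$ under $T^0_\varepsilon\times T^0_\varepsilon$, where $T^{\bar z}_\varepsilon(z,v)=([\varepsilon(\bar z+z)],v)$ for $\bar z\in\mathbb Z_\varepsilon^d=(\mathbb Z/\frac1\varepsilon\mathbb Z)^d$; for $x=([\varepsilon z],v)\in\mathcal X_\varepsilon$ write $x_{\mathsf z}=z\in\mathbb Z_\varepsilon^d$. Put $\tau^{\bar z}_\varepsilon m=m\circ T^{\bar z}_\varepsilon$, $\tau^{\bar z}_\varepsilon J=J\circ(T^{\bar z}_\varepsilon\times T^{\bar z}_\varepsilon)$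 and $$\mathcal F_\varepsilon(m,J)=\sum_{z\in\mathbb Z_\varepsilon^d}\varepsilon^d F\Big(\frac{\tau_\varepsilon^z m}{\varepsilon^d},\frac{\tau_\varepsilon^z J}{\varepsilon^{d-1}}\Big).$$ Let $\mathcal I=(a,b)$, $a<b$, be a bounded open interval. For $\boldsymbol m:\mathcal I\to\mathbb R_+^{\mathcal X_\varepsilon}$ let $$\mathcal A_\varepsilon^{\mathcal I}(\boldsymbol m)=\inf_{\boldsymbol J}\int_{\mathcal I}\mathcal F_\varepsilon(m_t,J_t)\,dt,$$ the infimum being over all Borel measurable $\boldsymbol J:\mathcal I\to\mathbb R_a^{\mathcal E_\varepsilon}$ that solve with $\boldsymbol m$ the discrete continuity equation, i.e. $\boldsymbol m$ is continuous and $\partial_t m_t(x)+\sum_{y:(x,y)\in\mathcal E_\varepsilon}J_t(x,y)=0$ in the sense of distributions on $\mathcal I$ for every $x\in\mathcal X_\varepsilon$ (with $\inf\emptyset=+\infty$). Set $\boldsymbol m(\mathcal I\times\mathcal X_\varepsilon)=\int_{\mathcal I}\sum_x m_t(x)\,dt$, and for $m\in\mathbb R_+^{\mathcal X_\varepsilon}$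 $$\iota_\varepsilon m=\varepsilon^{-d}\sum_{x\in\mathcal X_\varepsilon}m(x)\,\mathscr L^d|_{\varepsilon x_{\mathsf z}+[0,\varepsilon)^d}\in\mathcal M_+(\mathbb T^d),\qquad \mathbb T^d=\mathbb R^d/\mathbb Z^d.$$ Finally, $\mathrm{BV}_{\mathrm{KR}}(\mathcal I;\mathcal M_+(\mathbb T^d))$ is the set of measurable curves $(\mu_t)_{t\in\mathcal I}$ of finite positive measures on $\mathbb T^d$ with $\int_{\mathcal I}\mu_t(\mathbb T^d)\,dt<\infty$ and $$\sup\Big\{\int_{\mathcal I}\int_{\mathbb T^d}\partial_t\varphi_t\,d\mu_t\,dt\ :\ \varphi\in C_c^1(\mathcal I;C^1(\mathbb T^d)),\ \sup_t\|\varphi_t\|_{C^1(\mathbb T^d)}\le1\Big\}<\infty,$$ where $\|\psi\|_{C^1(\mathbb T^d)}=\max\{\|\psi\|_\infty,\|\nabla\psi\|_\infty\}$. *Theorem.* Let $\varepsilon\to0$ along any sequence of values with $1/\varepsilon\in\mathbb N$ and $\varepsilon R_0<\frac12$, and let $\boldsymbol m^\varepsilon:\mathcal I\to\mathbb R_+^{\mathcal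 X_\varepsilon}$ be curves, one for each term of the sequence, such that $$\sup_\varepsilon\mathcal A_\varepsilon^{\mathcal I}(\boldsymbol m^\varepsilon)<\infty\quad\text{and}\quad\sup_\varepsilon\boldsymbol m^\varepsilon(\mathcal I\times\mathcal X_\varepsilon)<\infty.$$ Then there exists a curve $(\mu_t)_{t\in\mathcal I}\in\mathrm{BV}_{\mathrm{KR}}(\mathcal I;\mathcal M_+(\mathbb T^d))$ such that, along a subsequence, (i) the measures $\iota_\varepsilon m_t^\varepsilon(dx)\,dt$ are finite and converge weakly to $\mu_t(dx)\,dt$ in $\mathcal M_+(\mathcal I\times\mathbb T^d)$ (i.e. against bounded continuous functions); (ii) $\iota_\varepsilon m_t^\varepsilon\to\mu_t$ weakly in $\mathcal M_+(\mathbb T^d)$ for almost every $t\in\mathcal I$; (iii) $t\mapsto\mu_t(\mathbb T^d)$ is constant on $\mathcal I$. -/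

import Mathlib

open MeasureTheory Set Filter Topology
open scoped NNReal ENNReal ContDiff

noncomputable section

namespace PeriodicTransport

/-! ### Periodic graphs and admissible cost functions -/

/-- The vertex set `ℤ^d × V`. -/
abbrev Vertex (d : ℕ) (V : Type*) := (Fin d → ℤ) × V

/-- The shift operator `(z', v) ↦ (z + z', v)`. -/
def shift {d : ℕ} {V : Type*} (z : Fin d → ℤ) (x : Vertex d V) : Vertex d V := (z + x.1, x.2)

/-- A connected, `ℤ^d`-periodic graph of bounded degree (in particular locally finite)
on `ℤ^d × V`, given by its symmetric set of ordered edges. -/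
structure PeriodicGraph (d : ℕ) (V : Type*) where
  edges : Set (Vertex d V × Vertex d V)
  symm : ∀ x y, (x, y) ∈ edges → (y, x) ∈ edges
  periodic : ∀ (z : Fin d → ℤ) (x y : Vertex d V),
    (x, y) ∈ edges ↔ (shift z x, shift z y) ∈ edges
  boundedDegree : ∃ D : ℕ, ∀ x, {y | (x, y) ∈ edges}.encard ≤ D
  connected : ∀ x y, Relation.ReflTransGen (fun x' y' => (x', y') ∈ edges) x y

/-- The space of antisymmetric functions on a set `E` of ordered edges. -/
def Flux {X : Type*} (E : Set (X × X)) : Submodule ℝ (E → ℝ) where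
  carrier := {J | ∀ e e' : E, (e' : X × X) = (e : X × X).swap → J e' = -J e}
  zero_mem' := by intro e e' _; simp
  add_mem' := by
    intro J K hJ hK e e' h
    simp only [Pi.add_apply, hJ e e' h, hK e e' h]
    ring
  smul_mem' := by
    intro c J hJ e e' h
    simp only [Pi.smul_apply, hJ e e' h, smul_eq_mul]
    ring

/-- The discrete divergence `x ↦ ∑_{y ∼ x} J (x, y)`. -/
def divergence {X : Type*} {E : Set (X × X)} (J : Flux E) (x : X) : ℝ :=
  ∑ᶠ (e : E) (_ : (e : X × X).1 = x), (J : E → ℝ) e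

variable {d : ℕ} {V : Type*}

/-- The maximal edge length `R₀`, in the supremum norm of the `ℤ^d`-components. -/
def PeriodicGraph.maxEdgeLength (G : PeriodicGraph d V) : ℝ :=
  sSup ((fun e : Vertex d V × Vertex d V => ‖e.1.1 - e.2.1‖) '' G.edges)

/-- The assumptions on a cost function `F : ℝ_+^𝒳 × ℝ_a^ℰ → ℝ ∪ {+∞}`. -/
structure AdmissibleCost (G : PeriodicGraph d V)
    (F : (Vertex d V → ℝ≥0) × Flux G.edges → EReal) : Prop where
  ne_bot : ∀ p, F p ≠ ⊥
  convex : ∀ (p q : (Vertex d V → ℝ≥0) × Flux G.edges) (s t : ℝ≥0), s + t = 1 →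
    F (s • p + t • q) ≤ ((s : ℝ) : EReal) * F p + ((t : ℝ) : EReal) * F q
  lowerSemicontinuous : LowerSemicontinuous F
  /-- Locality with some radius `R₁`, and at least linear growth. -/
  local_growth : ∃ R₁ : ℝ,
    (∀ (m m' : Vertex d V → ℝ≥0) (J J' : Flux G.edges),
      (∀ x, ‖x.1‖ ≤ R₁ → m x = m' x) →
      (∀ e : G.edges, ‖e.1.1.1‖ ≤ R₁ → ‖e.1.2.1‖ ≤ R₁ →
        (J : G.edges → ℝ) e = (J' : G.edges → ℝ) e) →
      F (m, J) = F (m', J')) ∧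
    ∃ c C : ℝ, 0 < c ∧ ∀ (m : Vertex d V → ℝ≥0) (J : Flux G.edges),
      ((c * (∑ᶠ (e : G.edges) (_ : e.1.1.1 = 0), |(J : G.edges → ℝ) e|)
        - C * (1 + ∑ᶠ (x : Vertex d V) (_ : ‖x.1‖ ≤ max G.maxEdgeLength R₁), (m x : ℝ)) : ℝ)
          : EReal) ≤ F (m, J)
  /-- A periodic, divergence-free pair in the interior of the domain of `F`. -/
  interior_domain : ∃ (m₀ : Vertex d V → ℝ≥0) (J₀ : Flux G.edges),
    (∀ z x, m₀ (shift z x) = m₀ x) ∧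
    (∀ (z : Fin d → ℤ) (e e' : G.edges), (e' : Vertex d V × Vertex d V) =
      (shift z e.1.1, shift z e.1.2) → (J₀ : G.edges → ℝ) e' = (J₀ : G.edges → ℝ) e) ∧
    (∀ x, divergence J₀ x = 0) ∧
    (m₀, J₀) ∈ interior {p | F p < ⊤}

/-! ### The rescaled setting, with mesh size `ε = 1 / N` -/

/-- The vertices `𝒳_ε = 𝕋_ε^d × V`; the discrete torus `𝕋_ε^d = ε (ℤ/Nℤ)^d` is indexed by
`(ℤ/Nℤ)^d`. -/
abbrev RVertex (d N : ℕ) (V : Type*) := (Fin d → ZMod N) × V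

/-- The mesh size `ε = 1 / N`. -/
def mesh (N : ℕ) : ℝ≥0 := 1 / N

/-- The wrapping map `T_ε^z : 𝒳 → 𝒳_ε`. -/
def wrap (N : ℕ) (z : Fin d → ZMod N) (x : Vertex d V) : RVertex d N V :=
  (fun i => z i + (x.1 i : ZMod N), x.2)

/-- The edges `ℰ_ε`, the image of `ℰ` under `T_ε^0`. -/
def PeriodicGraph.redges (G : PeriodicGraph d V) (N : ℕ) :
    Set (RVertex d N V × RVertex d N V) :=
  (fun e => (wrap N 0 e.1, wrap N 0 e.2)) '' G.edges

theorem PeriodicGraph.wrap_mem (G : PeriodicGraph d V) (N : ℕ) (z : Fin d → ZMod N)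
    (e : Vertex d V × Vertex d V) (he : e ∈ G.edges) :
    (wrap N z e.1, wrap N z e.2) ∈ G.redges N := by
  choose w hw using fun i => ZMod.intCast_surjective (z i)
  refine ⟨(shift w e.1, shift w e.2), (G.periodic w e.1 e.2).1 he, ?_⟩
  simp [wrap, shift, hw]

/-- The pullback `τ_ε^z m` of a function on `𝒳_ε` to `𝒳`. -/
def pullMass {N : ℕ} (z : Fin d → ZMod N) (m : RVertex d N V → ℝ≥0) : Vertex d V → ℝ≥0 :=
  fun x => m (wrap N z x)

/-- The pullback `τ_ε^z J` of a function on `ℰ_ε` to `ℰ`. -/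
def pullFlux (G : PeriodicGraph d V) {N : ℕ} (z : Fin d → ZMod N) (J : Flux (G.redges N)) :
    Flux G.edges :=
  ⟨fun e => (J : G.redges N → ℝ) ⟨(wrap N z e.1.1, wrap N z e.1.2), G.wrap_mem N z e.1 e.2⟩, by
    intro e e' h
    refine J.2 _ _ ?_
    simp [h]⟩

/-- The rescaled energy `𝓕_ε(m, J) = ∑_z ε^d F(τ_ε^z m / ε^d, τ_ε^z J / ε^(d-1))`. -/
def energy [Fintype V] (G : PeriodicGraph d V)
    (F : (Vertex d V → ℝ≥0) × Flux G.edges → EReal) (N : ℕ) [NeZero N]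
    (m : RVertex d N V → ℝ≥0) (J : Flux (G.redges N)) : EReal :=
  ∑ z : Fin d → ZMod N, (((mesh N ^ d : ℝ≥0) : ℝ) : EReal) *
    F ((mesh N ^ d)⁻¹ • pullMass z m, (mesh N ^ ((d : ℤ) - 1))⁻¹ • pullFlux G z J)

/-! ### Curves on the time interval `(a, b)` and the discrete action -/

/-- Lebesgue measure on the interval `(a, b)`. -/
def timeMeasure (a b : ℝ) : Measure (Ioo a b) := Measure.comap Subtype.val volume

/-- The integral of an extended-real-valued function, as the integral of the positive part minus
the integral of the negative part. -/
def erealIntegral {α : Type*} [MeasurableSpace α] (μ : Measure α) (f : α → EReal) : EReal :=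
  ((∫⁻ t, (f t).toENNReal ∂μ : ℝ≥0∞) : EReal) - ((∫⁻ t, (-f t).toENNReal ∂μ : ℝ≥0∞) : EReal)

/-- Solutions `(m, J)` of the discrete continuity equation `∂_t m_t + div J_t = 0` on `(a, b)`,
in the sense of distributions. -/
structure DiscreteCE (G : PeriodicGraph d V) (N : ℕ) (a b : ℝ)
    (m : Ioo a b → RVertex d N V → ℝ≥0) (J : Ioo a b → Flux (G.redges N)) : Prop where
  continuous_mass : Continuous m
  measurable_flux : Measurable fun t => (J t : G.redges N → ℝ)
  /-- The divergence is a distribution on `(a, b)`. -/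
  locallyIntegrable_div : ∀ x, LocallyIntegrable (fun t => divergence (J t) x) (timeMeasure a b)
  weak_eq : ∀ (x : RVertex d N V) (η : ℝ → ℝ), ContDiff ℝ ∞ η → HasCompactSupport η →
    tsupport η ⊆ Ioo a b →
    -(∫ t : Ioo a b, deriv η t * (m t x : ℝ) ∂timeMeasure a b)
      + ∫ t : Ioo a b, η t * divergence (J t) x ∂timeMeasure a b = 0

/-- The action `𝓐_ε(m) = inf {∫ 𝓕_ε(m_t, J_t) dt : (m, J) solves the continuity equation}`. -/
def action [Fintype V] (G : PeriodicGraph d V)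
    (F : (Vertex d V → ℝ≥0) × Flux G.edges → EReal) (N : ℕ) [NeZero N] (a b : ℝ)
    (m : Ioo a b → RVertex d N V → ℝ≥0) : EReal :=
  ⨅ (J : Ioo a b → Flux (G.redges N)) (_ : DiscreteCE G N a b m J),
    erealIntegral (timeMeasure a b) fun t => energy G F N (m t) (J t)

/-- The total space-time mass `∫ ∑_x m_t(x) dt`. -/
def totalMass [Fintype V] (N : ℕ) [NeZero N] (a b : ℝ)
    (m : Ioo a b → RVertex d N V → ℝ≥0) : ℝ≥0∞ :=
  ∫⁻ t, ∑ x, (m t x : ℝ≥0∞) ∂timeMeasure a b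

/-! ### Embedding into measures on the torus `𝕋^d = ℝ^d / ℤ^d` -/

/-- The torus `ℝ^d / ℤ^d`. -/
abbrev Torus (d : ℕ) := UnitAddTorus (Fin d)

/-- The cube `Q_ε^z = ε z + [0, ε)^d`, as a subset of the torus. -/
def cube (N : ℕ) (z : Fin d → ZMod N) : Set (Torus d) :=
  (fun (w : Fin d → ℝ) i => (w i : UnitAddCircle)) ''
    {w | ∀ i, w i ∈ Ico ((mesh N : ℝ) * (z i).val) ((mesh N : ℝ) * (z i).val + mesh N)}

/-- The embedding `ι_ε m = ε^(-d) ∑_x m(x) ℒ^d|_{Q_ε^{x_z}}`. -/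
def embed [Fintype V] {N : ℕ} [NeZero N] (m : RVertex d N V → ℝ≥0) : Measure (Torus d) :=
  (mesh N ^ d)⁻¹ • ∑ x, m x • (volume : Measure (Torus d)).restrict (cube N x.1)

/-- The measure `μ_t(dx) dt` on `(a, b) × 𝕋^d`. -/
def spaceTime {a b : ℝ} (μ : Ioo a b → Measure (Torus d)) : Measure (Ioo a b × Torus d) :=
  (timeMeasure a b).bind fun t => (μ t).map (Prod.mk t)

/-- Weak convergence of finite measures, tested against bounded continuous functions. -/
def WeakTendsto {X : Type*} [TopologicalSpace X] [MeasurableSpace X] [OpensMeasurableSpace X]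
    (μs : ℕ → Measure X) (μ : Measure X) : Prop :=
  ∃ (hs : ∀ n, IsFiniteMeasure (μs n)) (h : IsFiniteMeasure μ),
    Tendsto (β := FiniteMeasure X) (fun n => ⟨μs n, hs n⟩) atTop (𝓝 ⟨μ, h⟩)

/-! ### Curves of bounded variation with respect to the Kantorovich-Rubinstein norm -/

/-- The Banach space `C¹(𝕋^d)`, as the space of pairs `(ψ, ∇ψ)`, with the inherited norm
`max (sup |ψ|) (sup |∇ψ|)`. -/
def C1Torus (d : ℕ) : Submodule ℝ (C(Torus d, ℝ) × C(Torus d, EuclideanSpace ℝ (Fin d))) where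
  carrier := {p | ∀ w : EuclideanSpace ℝ (Fin d),
    HasGradientAt (fun w' : EuclideanSpace ℝ (Fin d) => p.1 fun i => (w' i : UnitAddCircle))
      (p.2 fun i => (w i : UnitAddCircle)) w}
  zero_mem' := by
    intro w
    simpa using hasGradientAt_const w (0 : ℝ)
  add_mem' := by
    intro p q hp hq w
    rw [hasGradientAt_iff_hasFDerivAt]
    have h := (hp w).hasFDerivAt.add (hq w).hasFDerivAt
    rw [← map_add] at h
    exact h
  smul_mem' := by
    intro c p hp w
    rw [hasGradientAt_iff_hasFDerivAt]
    have h := (hp w).hasFDerivAt.const_smul c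
    rw [← map_smul] at h
    exact h

/-- The seminorm of a curve `μ` in `BV_KR((a, b); 𝓜_+(𝕋^d))`: the supremum of
`∫ ∫ ∂_t φ_t dμ_t dt` over `φ ∈ C_c¹((a, b); C¹(𝕋^d))` with `‖φ_t‖_{C¹} ≤ 1` for all `t`. -/
def bvSeminorm {a b : ℝ} (μ : Ioo a b → Measure (Torus d)) : EReal :=
  ⨆ (φ : ℝ → C1Torus d) (_ : ContDiff ℝ 1 φ ∧ HasCompactSupport φ ∧ tsupport φ ⊆ Ioo a b ∧
      ∀ t, ‖φ t‖ ≤ 1),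
    ((∫ t : Ioo a b, ∫ x, (deriv φ t).1.1 x ∂μ t ∂timeMeasure a b : ℝ) : EReal)

/-- The space `BV_KR((a, b); 𝓜_+(𝕋^d))`: measurable curves of finite measures, with integrable
mass, of finite seminorm. -/
structure MemBVKR {a b : ℝ} (μ : Ioo a b → Measure (Torus d)) : Prop where
  finite : ∀ t, IsFiniteMeasure (μ t)
  measurable : Measurable μ
  integrable_mass : ∫⁻ t, μ t univ ∂timeMeasure a b < ⊤
  seminorm_lt_top : bvSeminorm μ < ⊤

end PeriodicTransport

end

open PeriodicTransport

namespace PeriodicTransport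

/-! ### Helly's selection principle for curves of measures -/

/-! Linear growth of the cost turns the bound on action and mass into a bound, uniform in `ε`, on `∫
ε ∑ |J_t| dt` (`AdmissibleCost.exists_le_energy`). Integrating `ψ` against `ι_ε m_t` is the same as
pairing `m_t` with the averages of `ψ` over the cubes, and these averages differ by at most `Lip(ψ)
ε R₀` across an edge. The continuity equation, summed by parts over the edges, therefore controls
the increments of `t ↦ ∫ ψ dι_ε m_t` by `Lip(ψ)` times the increments of a bounded monotone function
(`AdmissibleCost.exists_variation_bound`). For `ψ = 1` the Lipschitz constant is zero, so the mass
is constant in time, and the space-time mass bound becomes a bound at every time.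

Compactness then follows Helly's principle (`exists_subseq_tendsto_of_variation`). Along a
subsequence the measures converge at rational times and the variation functions converge to a
monotone limit. At each continuity point of that limit, hence off a countable set, the measures
converge too, by comparison with a nearby rational time. Dominated convergence gives convergence in
space-time. The BV bound is proved for each `ε` by moving a difference quotient from the test
function to the curve (`integral_deriv_le_of_variation`), and it passes to the limit for each fixed
test function (`bvSeminorm_le`). -/

theorem exists_subseq_tendsto_of_bounded {ι : Type*} [Countable ι] (f : ℕ → ι → ℝ) (C : ι → ℝ)
    (h : ∀ n i, |f n i| ≤ C i) :
    ∃ φ : ℕ → ℕ, StrictMono φ ∧ ∀ i, ∃ l, Tendsto (fun n => f (φ n) i) atTop (𝓝 l) := by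
  have hK : IsCompact (Set.pi univ fun i => Icc (-C i) (C i)) :=
    isCompact_univ_pi fun i => isCompact_Icc
  obtain ⟨l, -, φ, hφ, hl⟩ := hK.tendsto_subseq (x := f) fun n i _ => abs_le.1 (h n i)
  exact ⟨φ, hφ, fun i => ⟨l i, (tendsto_pi_nhds.1 hl) i⟩⟩

/-- Such an `x` is Cauchy. The comparison sequence may change with `ε`, which lets one statement
serve both for dense test functions and for rational times. -/
theorem exists_tendsto_of_approx (x : ℕ → ℝ)
    (h : ∀ ε > 0, ∃ y : ℕ → ℝ, (∃ l, Tendsto y atTop (𝓝 l)) ∧ ∀ᶠ k in atTop, |x k - y k| ≤ ε) :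
    ∃ l, Tendsto x atTop (𝓝 l) := by
  apply cauchySeq_tendsto_of_complete
  rw [Metric.cauchySeq_iff]
  intro ε hε
  obtain ⟨y, ⟨l, hl⟩, hy⟩ := h (ε / 4) (by positivity)
  obtain ⟨n, hn⟩ := eventually_atTop.1 hy
  obtain ⟨p, hp⟩ := Metric.cauchySeq_iff.1 hl.cauchySeq (ε / 4) (by positivity)
  refine ⟨max n p, fun i hi j hj => ?_⟩
  have h1 := hn i ((le_max_left _ _).trans hi)
  have h2 := hn j ((le_max_left _ _).trans hj)
  have h3 := hp i ((le_max_right _ _).trans hi) j ((le_max_right _ _).trans hj)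
  rw [Real.dist_eq] at h3 ⊢
  rw [abs_le] at h1 h2
  rw [abs_lt] at h3 ⊢
  constructor <;> linarith

section Measures

variable {X : Type*} [MetricSpace X] [MeasurableSpace X] [BorelSpace X]

theorem abs_integral_sub_integral_le [CompactSpace X] (μ : FiniteMeasure X) (f g : C(X, ℝ)) :
    |∫ x, f x ∂(μ : Measure X) - ∫ x, g x ∂(μ : Measure X)| ≤ μ.mass * ‖f - g‖ := by
  rw [← integral_sub (f.continuous.integrable_of_hasCompactSupport (.of_compactSpace _))
    (g.continuous.integrable_of_hasCompactSupport (.of_compactSpace _))]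
  refine (norm_integral_le_of_norm_le_const (C := ‖f - g‖)
    (Eventually.of_forall fun x => (f - g).norm_coe_le_norm x)).trans_eq ?_
  rw [mul_comm]
  rfl

/-- Thickened indicators of a closed set are Lipschitz and their integrals converge to its measure;
closed sets form a generating π-system. -/
theorem finiteMeasure_eq_of_lipschitz {μ ν : FiniteMeasure X}
    (h : ∀ (f : X → ℝ) (L : ℝ≥0), LipschitzWith L f →
      ∫ x, f x ∂(μ : Measure X) = ∫ x, f x ∂(ν : Measure X)) : μ = ν := by
  have key : ∀ s : Set X, IsClosed s → (μ : Measure X) s = (ν : Measure X) s := by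
    intro s hs
    have hδ : ∀ n : ℕ, (0 : ℝ) < 1 / (n + 1) := fun n => by positivity
    have h1 := tendsto_integral_thickenedIndicator_of_isClosed (μ : Measure X) hs hδ
      tendsto_one_div_add_atTop_nhds_zero_nat
    have h2 := tendsto_integral_thickenedIndicator_of_isClosed (ν : Measure X) hs hδ
      tendsto_one_div_add_atTop_nhds_zero_nat
    have h3 : ∀ n : ℕ, ∫ x, (thickenedIndicator (hδ n) s x : ℝ) ∂(μ : Measure X)
        = ∫ x, (thickenedIndicator (hδ n) s x : ℝ) ∂(ν : Measure X) := fun n =>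
      h _ _ (lipschitzWith_thickenedIndicator (hδ n) s)
    simp_rw [h3] at h1
    exact (measureReal_eq_measureReal_iff).1 (tendsto_nhds_unique h1 h2)
  apply FiniteMeasure.toMeasure_injective
  refine ext_of_generate_finite _ ?_ isPiSystem_isClosed key (key _ isClosed_univ)
  rw [← borel_eq_generateFrom_isClosed]
  exact BorelSpace.measurable_eq

/-- Measures of mass at most `C` on a compact space form a weakly compact set. The limits of
Lipschitz integrals determine every cluster point, so there is only one, and the sequence converges
to it. -/
theorem exists_tendsto_of_lipschitz [CompactSpace X] (μ : ℕ → FiniteMeasure X) (C : ℝ≥0)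
    (hC : ∀ n, (μ n).mass ≤ C)
    (h : ∀ (f : X → ℝ) (L : ℝ≥0), LipschitzWith L f →
      ∃ l, Tendsto (fun n => ∫ x, f x ∂(μ n : Measure X)) atTop (𝓝 l)) :
    ∃ ν, Tendsto μ atTop (𝓝 ν) := by
  have hK := isCompact_setOfPred_finiteMeasure_le_of_compactSpace X C
  have key : ∀ ν, MapClusterPt ν atTop μ → ∀ (f : X → ℝ) (L : ℝ≥0), LipschitzWith L f →
      ∀ l, Tendsto (fun n => ∫ x, f x ∂(μ n : Measure X)) atTop (𝓝 l) →
      ∫ x, f x ∂(ν : Measure X) = l := by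
    intro ν hν f L hf l hl
    obtain ⟨U, hU, hU'⟩ := mapClusterPt_iff_ultrafilter.1 hν
    have := (FiniteMeasure.tendsto_iff_forall_integral_tendsto.1 hU')
      (BoundedContinuousFunction.mkOfCompact ⟨f, hf.continuous⟩)
    exact tendsto_nhds_unique this (hl.mono_left hU)
  obtain ⟨ν, -, hν⟩ := hK.exists_mapClusterPt (f := atTop) (u := μ)
    (tendsto_principal.2 (Eventually.of_forall hC))
  refine ⟨ν, hK.tendsto_nhds_of_unique_mapClusterPt (Eventually.of_forall hC) fun ν' _ hν' => ?_⟩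
  refine finiteMeasure_eq_of_lipschitz fun f L hf => ?_
  obtain ⟨l, hl⟩ := h f L hf
  rw [key ν hν f L hf l hl, key ν' hν' f L hf l hl]

theorem exists_subseq_forall_integral_tendsto [CompactSpace X] {ι : Type*} [Countable ι]
    (μ : ℕ → ι → FiniteMeasure X) (C : ℝ≥0) (hC : ∀ n i, (μ n i).mass ≤ C) :
    ∃ φ : ℕ → ℕ, StrictMono φ ∧ ∀ i (f : C(X, ℝ)),
      ∃ l, Tendsto (fun n => ∫ x, f x ∂(μ (φ n) i : Measure X)) atTop (𝓝 l) := by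
  let ψ : ℕ → C(X, ℝ) := TopologicalSpace.denseSeq _
  obtain ⟨φ, hφ, h⟩ := exists_subseq_tendsto_of_bounded
    (fun n (p : ι × ℕ) => ∫ x, ψ p.2 x ∂(μ n p.1 : Measure X)) (fun p => C * ‖ψ p.2‖) (by
      intro n p
      have := abs_integral_sub_integral_le (μ n p.1) (ψ p.2) 0
      simp only [ContinuousMap.zero_apply, integral_zero, sub_zero] at this
      exact this.trans (by gcongr; exact hC _ _))
  refine ⟨φ, hφ, fun i f => exists_tendsto_of_approx _ fun ε hε => ?_⟩
  -- Dividing by `C + 1` rather than `C` covers `C = 0`.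
  obtain ⟨j, hj⟩ := (TopologicalSpace.denseRange_denseSeq C(X, ℝ)).exists_dist_lt f
    (ε := ε / (C + 1)) (by positivity)
  refine ⟨_, h (i, j), Eventually.of_forall fun n => ?_⟩
  refine (abs_integral_sub_integral_le _ _ _).trans ?_
  rw [← dist_eq_norm]
  calc ((μ (φ n) i).mass : ℝ) * dist f (ψ j) ≤ (C + 1) * (ε / (C + 1)) := by
        gcongr
        have : ((μ (φ n) i).mass : ℝ) ≤ C := hC _ _
        linarith
    _ = ε := by field_simp

/-- Helly's selection principle: a bounded sequence of curves of measures whose variation,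
in duality with Lipschitz functions, is controlled by uniformly bounded monotone functions,
has a subsequence converging weakly at all but countably many times. -/
theorem exists_subseq_tendsto_of_variation [CompactSpace X] {a b : ℝ}
    (μ : ℕ → Ioo a b → FiniteMeasure X) (C : ℝ≥0)
    (hC : ∀ n t, (μ n t).mass ≤ C) (v : ℕ → ℝ → ℝ) (hv : ∀ n, Monotone (v n)) (B : ℝ)
    (hB : ∀ n t, |v n t| ≤ B)
    (hμ : ∀ n (f : X → ℝ) (L : ℝ≥0), LipschitzWith L f → ∀ s t : Ioo a b, s ≤ t →
      |∫ x, f x ∂(μ n t : Measure X) - ∫ x, f x ∂(μ n s : Measure X)| ≤ L * (v n t - v n s)) :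
    ∃ φ : ℕ → ℕ, StrictMono φ ∧ ∃ S : Set (Ioo a b), S.Countable ∧
      ∀ t ∉ S, ∃ ν, Tendsto (fun n => μ (φ n) t) atTop (𝓝 ν) := by
  obtain ⟨φ₁, hφ₁, h₁⟩ := exists_subseq_tendsto_of_bounded (fun n (q : ℚ) => v n q) (fun _ => B)
    (fun n q => hB n q)
  obtain ⟨φ₂, hφ₂, h₂⟩ := exists_subseq_forall_integral_tendsto
    (ι := {q : ℚ // (q : ℝ) ∈ Ioo a b}) (fun n q => μ (φ₁ n) ⟨q.1, q.2⟩) C (fun n q => hC _ _)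
  let φ := φ₁ ∘ φ₂
  choose w hw using h₁
  replace hw : ∀ q : ℚ, Tendsto (fun n => v (φ n) q) atTop (𝓝 (w q)) := fun q =>
    (hw q).comp hφ₂.tendsto_atTop
  -- Convergence is known only at rationals; elsewhere `limUnder` may be a junk value. Hence `u` is
  -- used only on the range of `ℚ`, and `g` below extends it monotonically.
  let u : ℝ → ℝ := fun t => limUnder atTop fun n => v (φ n) t
  have hu : ∀ q : ℚ, u q = w q := fun q => (hw q).limUnder_eq
  have hwB : ∀ q, |w q| ≤ B := fun q => le_of_tendsto (hw q).abs (Eventually.of_forall fun n =>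
    hB _ _)
  have humono : MonotoneOn u (range ((↑) : ℚ → ℝ)) := by
    rintro _ ⟨p, rfl⟩ _ ⟨q, rfl⟩ hpq
    rw [hu, hu]
    exact le_of_tendsto_of_tendsto' (hw p) (hw q) fun n => hv _ hpq
  obtain ⟨g, hg, hgu⟩ := humono.exists_monotone_extension
    ⟨-B, by rintro _ ⟨_, ⟨q, rfl⟩, rfl⟩; rw [hu]; exact (abs_le.1 (hwB q)).1⟩
    ⟨B, by rintro _ ⟨_, ⟨q, rfl⟩, rfl⟩; rw [hu]; exact (abs_le.1 (hwB q)).2⟩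
  have hgw : ∀ q : ℚ, g q = w q := fun q => by rw [← hu, hgu ⟨q, rfl⟩]
  refine ⟨φ, hφ₁.comp hφ₂, {t | ¬ ContinuousAt g t},
    hg.countable_not_continuousAt.preimage Subtype.val_injective, fun t ht => ?_⟩
  replace ht : ContinuousAt g t := not_not.1 ht
  refine exists_tendsto_of_lipschitz _ C (fun n => hC _ _) fun f L hf =>
    exists_tendsto_of_approx _ fun ε hε => ?_
  obtain ⟨δ, hδ, hδ'⟩ := Metric.continuousAt_iff.1 ht (ε / (2 * (L + 1))) (by positivity)
  obtain ⟨p, hp, hp'⟩ := exists_rat_btwn (show max a (t - δ) < t from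
    max_lt t.2.1 (by linarith))
  obtain ⟨q, hq, hq'⟩ := exists_rat_btwn (show (t : ℝ) < min b (t + δ) from
    lt_min t.2.2 (by linarith))
  rw [max_lt_iff] at hp
  rw [lt_min_iff] at hq'
  have hpI : (p : ℝ) ∈ Ioo a b := ⟨hp.1, hp'.trans t.2.2⟩
  have hp1 := hδ' (x := p) (by rw [Real.dist_eq, abs_lt]; constructor <;> linarith [hp.2])
  have hq1 := hδ' (x := q) (by rw [Real.dist_eq, abs_lt]; constructor <;> linarith [hq'.2])
  rw [Real.dist_eq, abs_lt, hgw] at hp1 hq1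
  have hlt : w q - w p < ε / (L + 1) := by
    have : ε / (L + 1) = ε / (2 * (L + 1)) + ε / (2 * (L + 1)) := by field_simp; ring
    linarith [hp1.1, hq1.2]
  -- The comparison sequence is the one at the rational time `p < t`. The error is at most `L (v t -
  -- v p) ≤ L (v q - v p)`, and the limit of `v q - v p` is small since `g` is continuous at `t`.
  refine ⟨_, h₂ ⟨p, hpI⟩ ⟨f, hf.continuous⟩, ?_⟩
  filter_upwards [((hw q).sub (hw p)).eventually_lt_const hlt] with n hn
  refine (hμ (φ n) f L hf ⟨p, hpI⟩ t hp'.le).trans ?_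
  have h3 : v (φ n) t ≤ v (φ n) q := hv _ hq.le
  calc (L : ℝ) * (v (φ n) t - v (φ n) p) ≤ L * (ε / (L + 1)) := by gcongr; linarith
    _ ≤ (L + 1) * (ε / (L + 1)) := by gcongr; linarith
    _ = ε := by field_simp

/-- The measure of a closed set is a limit of integrals of thickened indicators, and closed sets
form a generating π-system. -/
theorem measurable_of_measurable_integral {α : Type*} [MeasurableSpace α] {μ : α → Measure X}
    [∀ t, IsFiniteMeasure (μ t)] (h : ∀ f : C(X, ℝ), Measurable fun t => ∫ x, f x ∂μ t) :
    Measurable μ := by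
  have key : ∀ s : Set X, IsClosed s → Measurable fun t => μ t s := by
    intro s hs
    have hδ : ∀ n : ℕ, (0 : ℝ) < 1 / (n + 1) := fun n => by positivity
    have : Measurable fun t => (μ t).real s := measurable_of_tendsto_metrizable
      (fun n => h ⟨fun x => (thickenedIndicator (hδ n) s x : ℝ),
        (lipschitzWith_thickenedIndicator (hδ n) s).continuous.subtype_val⟩)
      (tendsto_pi_nhds.2 fun t => tendsto_integral_thickenedIndicator_of_isClosed (μ t) hs hδ
        tendsto_one_div_add_atTop_nhds_zero_nat)
    simpa [ofReal_measureReal] using this.ennreal_ofReal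
  refine Measurable.measure_of_isPiSystem (S := {s | IsClosed s}) ?_ isPiSystem_isClosed key
    (key _ isClosed_univ)
  rw [← borel_eq_generateFrom_isClosed]
  exact BorelSpace.measurable_eq

end Measures

/-! ### Distributional solutions of ordinary differential equations -/

instance (a b : ℝ) : IsFiniteMeasure (timeMeasure a b) := by
  constructor
  rw [timeMeasure, comap_subtype_coe_apply measurableSet_Ioo, image_univ,
    Subtype.range_coe]
  exact measure_Ioo_lt_top

/-- Smooth approximation of the Heaviside function. The limit is `0` at the origin, so differences
of two translates approximate indicators of `Ioc` intervals. -/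
theorem tendsto_smoothTransition_mul (x : ℝ) :
    Tendsto (fun n : ℕ => Real.smoothTransition (n * x)) atTop (𝓝 (if 0 < x then 1 else 0)) := by
  split_ifs with h
  · refine tendsto_const_nhds.congr' ?_
    filter_upwards [(tendsto_natCast_atTop_atTop.atTop_mul_const h).eventually_ge_atTop 1] with n hn
    exact (Real.smoothTransition.one_of_one_le hn).symm
  · refine tendsto_const_nhds.congr fun n => ?_
    exact (Real.smoothTransition.zero_of_nonpos
      (mul_nonpos_of_nonneg_of_nonpos n.cast_nonneg (not_lt.1 h))).symm

theorem hasDerivAt_smoothTransition_mul_sub (n c r : ℝ) :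
    HasDerivAt (fun r => Real.smoothTransition (n * (r - c)))
      (n * deriv Real.smoothTransition (n * (r - c))) r := by
  have h1 : HasDerivAt Real.smoothTransition (deriv Real.smoothTransition (n * (r - c)))
      (n * (r - c)) :=
    ((Real.smoothTransition.contDiff (n := 1)).differentiable (by simp) _).hasDerivAt
  have h2 : HasDerivAt (fun r => n * (r - c)) n r := by
    simpa using ((hasDerivAt_id r).sub_const c).const_mul n
  rw [mul_comm]
  exact h1.comp r h2

theorem deriv_smoothTransition_of_neg {x : ℝ} (h : x < 0) : deriv Real.smoothTransition x = 0 := by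
  have : Real.smoothTransition =ᶠ[𝓝 x] fun _ => 0 := by
    filter_upwards [gt_mem_nhds h] with y hy using Real.smoothTransition.zero_of_nonpos hy.le
  rw [this.deriv_eq, deriv_const]

theorem deriv_smoothTransition_of_one_lt {x : ℝ} (h : 1 < x) :
    deriv Real.smoothTransition x = 0 := by
  have : Real.smoothTransition =ᶠ[𝓝 x] fun _ => 1 := by
    filter_upwards [lt_mem_nhds h] with y hy using Real.smoothTransition.one_of_one_le hy.le
  rw [this.deriv_eq, deriv_const]

theorem continuous_deriv_smoothTransition : Continuous (deriv Real.smoothTransition) :=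
  (Real.smoothTransition.contDiff (n := 1)).continuous_deriv (by simp)

/-- The kernels have integral one and live on `[c, c + 1/n]`. The substitution `u = n (r - c)` puts
them on `[0, 1]`, where dominated convergence applies. -/
theorem tendsto_integral_deriv_smoothTransition {a b : ℝ} (f : Ioo a b → ℝ) (hf : Continuous f)
    (c : Ioo a b) :
    Tendsto (fun n : ℕ => ∫ r : Ioo a b,
      (n * deriv Real.smoothTransition (n * (r - c))) * f r ∂timeMeasure a b) atTop (𝓝 (f c)) := by
  let F : ℝ → ℝ := Function.extend Subtype.val f 0
  have hF : ∀ r : Ioo a b, F r = f r := fun r => Subtype.val_injective.extend_apply f 0 r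
  have hFm : Measurable F :=
    (MeasurableEmbedding.subtype_coe measurableSet_Ioo).measurable_extend hf.measurable
      measurable_zero
  have hFc : ContinuousAt F c := by
    rw [← (isOpen_Ioo.isOpenEmbedding_subtypeVal).continuousAt_iff (x := c)]
    convert hf.continuousAt (x := c) using 1
    exact funext hF
  have hlim : Tendsto (fun n : ℕ => ∫ u in (0:ℝ)..1, deriv Real.smoothTransition u * F (u / n + c))
      atTop (𝓝 (∫ u in (0:ℝ)..1, deriv Real.smoothTransition u * F c)) := by
    -- `f` may be unbounded near the ends of the interval, so the dominating function uses a bound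
    -- near `c` only.
    have hclose : ∀ᶠ r in 𝓝 (c : ℝ), |F r| ≤ |F c| + 1 := by
      filter_upwards [hFc.abs.eventually_lt_const (show |F c| < |F c| + 1 by linarith)] with r hr
        using hr.le
    obtain ⟨δ, hδ, hδ'⟩ := Metric.eventually_nhds_iff.1 hclose
    have hu : ∀ u : ℝ, Tendsto (fun n : ℕ => u / n + c) atTop (𝓝 c) := fun u => by
      simpa using (tendsto_const_div_atTop_nhds_zero_nat u).add_const (c : ℝ)
    refine intervalIntegral.tendsto_integral_filter_of_dominated_convergence
      (fun u => |deriv Real.smoothTransition u| * (|F c| + 1)) ?_ ?_ ?_ ?_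
    · refine Eventually.of_forall fun n => Measurable.aestronglyMeasurable ?_
      exact continuous_deriv_smoothTransition.measurable.mul (hFm.comp (by fun_prop))
    · filter_upwards [(tendsto_one_div_atTop_nhds_zero_nat (𝕜 := ℝ)).eventually_lt_const hδ]
        with n hn
      refine Eventually.of_forall fun u hu => ?_
      rw [uIoc_of_le zero_le_one] at hu
      rw [norm_mul]
      refine mul_le_mul_of_nonneg_left (hδ' ?_) (norm_nonneg _)
      rw [Real.dist_eq, add_sub_cancel_right, abs_of_nonneg (by have := hu.1; positivity)]
      exact (div_le_div_of_nonneg_right hu.2 n.cast_nonneg).trans_lt hn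
    · exact ((continuous_deriv_smoothTransition.abs).mul continuous_const).intervalIntegrable _ _
    · exact Eventually.of_forall fun u _ => (hFc.tendsto.comp (hu u)).const_mul _
  have hone : ∫ u in (0:ℝ)..1, deriv Real.smoothTransition u * F c = f c := by
    rw [intervalIntegral.integral_mul_const, intervalIntegral.integral_deriv_eq_sub
      (fun x _ => (Real.smoothTransition.contDiff (n := 1)).differentiable (by simp) x)
      (continuous_deriv_smoothTransition.intervalIntegrable _ _), hF]
    simp
  rw [hone] at hlim
  refine hlim.congr' ?_
  filter_upwards [(tendsto_one_div_atTop_nhds_zero_nat (𝕜 := ℝ)).eventually_lt_const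
    (sub_pos.2 c.2.2), eventually_gt_atTop 0] with n hn hn0
  have hn0' : (0 : ℝ) < n := Nat.cast_pos.2 hn0
  calc ∫ u in (0:ℝ)..1, deriv Real.smoothTransition u * F (u / n + c)
      = ∫ u in (0:ℝ)..1, (fun r => deriv Real.smoothTransition (n * (r - c)) * F r) (u / n + c) := by
        congr 1
        ext u
        simp only [add_sub_cancel_right]
        rw [mul_div_cancel₀ _ hn0'.ne']
    _ = n * ∫ r in (c : ℝ)..(1 / n + c), deriv Real.smoothTransition (n * (r - c)) * F r := by
        refine (intervalIntegral.integral_comp_div_add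
          (fun r => deriv Real.smoothTransition (n * (r - c)) * F r) hn0'.ne' (c : ℝ)).trans ?_
        simp
    _ = ∫ r in Ioc (c : ℝ) (1 / n + c), (n * deriv Real.smoothTransition (n * (r - c))) * F r := by
        rw [intervalIntegral.integral_of_le (by have : (0:ℝ) < 1 / n := by positivity
                                                linarith), ← integral_const_mul]
        simp only [mul_assoc]
    _ = ∫ r in Ioo a b, (n * deriv Real.smoothTransition (n * (r - c))) * F r := by
        symm
        refine (setIntegral_eq_of_subset_of_ae_sdiff_eq_zero measurableSet_Ioo.nullMeasurableSet
          (fun r hr => ⟨c.2.1.trans hr.1, hr.2.trans_lt (by linarith)⟩) ?_)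
        have hne : ∀ᵐ r : ℝ, r ≠ c := by
          simp [ae_iff, measure_singleton]
        filter_upwards [hne] with r hrc hr
        rcases lt_or_gt_of_ne hrc with h | h
        · rw [deriv_smoothTransition_of_neg (mul_neg_of_pos_of_neg hn0' (by linarith))]
          simp
        · rw [deriv_smoothTransition_of_one_lt]
          · simp
          · have : 1 / n + (c : ℝ) < r := by
              by_contra h'
              exact hr.2 ⟨h, not_lt.1 h'⟩
            have h2 : 1 / (n : ℝ) < r - c := by linarith
            rwa [div_lt_iff₀' hn0'] at h2
    _ = _ := by
        rw [← integral_subtype_comap measurableSet_Ioo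
          (fun r => (n * deriv Real.smoothTransition (n * (r - c))) * F r)]
        simp only [hF]
        rfl

/-- A continuous function whose distributional derivative is integrable is the primitive of it. -/
theorem sub_eq_neg_setIntegral_of_weak {a b : ℝ} (f g : Ioo a b → ℝ) (hf : Continuous f)
    (hfi : Integrable f (timeMeasure a b)) (hg : Integrable g (timeMeasure a b))
    (h : ∀ η : ℝ → ℝ, ContDiff ℝ ∞ η → HasCompactSupport η → tsupport η ⊆ Ioo a b →
      -(∫ t : Ioo a b, deriv η t * f t ∂timeMeasure a b)
        + ∫ t : Ioo a b, η t * g t ∂timeMeasure a b = 0)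
    (s t : Ioo a b) (hst : s ≤ t) :
    f t - f s = -∫ r in Ioc s t, g r ∂timeMeasure a b := by
  -- A smooth approximation of the indicator of `(s, t]`, supported in `[s, t + 1/n]` and thus
  -- admissible once `1/n < b - t`.
  let η : ℕ → ℝ → ℝ := fun n r =>
    Real.smoothTransition (n * (r - s)) - Real.smoothTransition (n * (r - t))
  have hst' : (s : ℝ) ≤ t := hst
  have hη1 : ∀ n r, |η n r| ≤ 1 := fun n r => by
    rw [abs_le]
    constructor <;>
    linarith [Real.smoothTransition.nonneg (n * (r - s)), Real.smoothTransition.le_one (n * (r - s)),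
      Real.smoothTransition.nonneg (n * (r - t)), Real.smoothTransition.le_one (n * (r - t))]
  have hηd : ∀ n, ContDiff ℝ ∞ (η n) := fun n => by
    have : ContDiff ℝ ∞ Real.smoothTransition := Real.smoothTransition.contDiff
    exact (this.comp (by fun_prop)).sub (this.comp (by fun_prop))
  have hlim1 : Tendsto (fun n => ∫ r : Ioo a b, η n r * g r ∂timeMeasure a b) atTop
      (𝓝 (∫ r in Ioc s t, g r ∂timeMeasure a b)) := by
    rw [← integral_indicator measurableSet_Ioc]
    refine tendsto_integral_of_dominated_convergence (fun r => |g r|) ?_ hg.abs ?_ ?_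
    · intro n
      exact ((hηd n).continuous.comp continuous_subtype_val).aestronglyMeasurable.mul
        hg.aestronglyMeasurable
    · intro n
      refine Eventually.of_forall fun r => ?_
      rw [norm_mul]
      exact mul_le_of_le_one_left (norm_nonneg _) (hη1 n r)
    · refine Eventually.of_forall fun r => ?_
      have h1 := ((tendsto_smoothTransition_mul ((r : ℝ) - s)).sub
        (tendsto_smoothTransition_mul ((r : ℝ) - t))).mul_const (g r)
      convert h1 using 2
      simp only [indicator, mem_Ioc, sub_pos, Subtype.coe_lt_coe]
      by_cases h1 : s < r <;> by_cases h2 : t < r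
      · simp [h1, h2]
      · simp [h1, h2, not_lt.1 h2]
      · exact absurd (hst.trans_lt h2) h1
      · simp [h1, h2]
  have hlim2 : Tendsto (fun n => ∫ r : Ioo a b, deriv (η n) r * f r ∂timeMeasure a b) atTop
      (𝓝 (f s - f t)) := by
    have hint : ∀ (n : ℕ) (c : Ioo a b), Integrable (fun r : Ioo a b =>
        (n * deriv Real.smoothTransition (n * (r - c))) * f r) (timeMeasure a b) := fun n c => by
      have hk : Continuous fun r : ℝ => n * deriv Real.smoothTransition (n * (r - c)) :=
        continuous_const.mul (continuous_deriv_smoothTransition.comp (by fun_prop))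
      obtain ⟨K, hK⟩ := isCompact_Icc.exists_bound_of_continuousOn (s := Icc a b) hk.continuousOn
      exact hfi.bdd_mul (hk.comp continuous_subtype_val).aestronglyMeasurable
        (Eventually.of_forall fun r : Ioo a b => hK r (Ioo_subset_Icc_self r.2))
    refine ((tendsto_integral_deriv_smoothTransition f hf s).sub
      (tendsto_integral_deriv_smoothTransition f hf t)).congr fun n => ?_
    rw [← integral_sub (hint n s) (hint n t)]
    congr 1
    ext r
    have hd : HasDerivAt (η n) _ r := (hasDerivAt_smoothTransition_mul_sub n s r).sub
      (hasDerivAt_smoothTransition_mul_sub n t r)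
    rw [hd.deriv, sub_mul]
  have hev : ∀ᶠ n in atTop, (∫ r : Ioo a b, deriv (η n) r * f r ∂timeMeasure a b)
      = ∫ r : Ioo a b, η n r * g r ∂timeMeasure a b := by
    filter_upwards [(tendsto_one_div_atTop_nhds_zero_nat (𝕜 := ℝ)).eventually_lt_const
      (sub_pos.2 t.2.2), eventually_gt_atTop 0] with n hn hn0
    have hn0' : (0 : ℝ) < n := Nat.cast_pos.2 hn0
    have hsub : tsupport (η n) ⊆ Icc (s : ℝ) (t + 1 / n) := by
      refine closure_minimal (fun r hr => ?_) isClosed_Icc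
      by_contra hr'
      apply hr
      rw [mem_Icc, not_and_or, not_le, not_le] at hr'
      simp only [η]
      rcases hr' with h | h
      · rw [Real.smoothTransition.zero_of_nonpos, Real.smoothTransition.zero_of_nonpos, sub_zero]
        · exact mul_nonpos_of_nonneg_of_nonpos hn0'.le (by linarith)
        · exact mul_nonpos_of_nonneg_of_nonpos hn0'.le (by linarith)
      · have h2 : 1 / (n : ℝ) < r - t := by linarith
        rw [div_lt_iff₀' hn0'] at h2
        rw [Real.smoothTransition.one_of_one_le, Real.smoothTransition.one_of_one_le, sub_self]
        · exact h2.le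
        · exact h2.le.trans (by gcongr)
    have := h (η n) (hηd n) (isCompact_Icc.of_isClosed_subset (isClosed_tsupport _) hsub)
      (hsub.trans fun r hr => ⟨s.2.1.trans_le hr.1, hr.2.trans_lt (by linarith)⟩)
    linarith
  have := tendsto_nhds_unique (hlim2.congr' hev) hlim1
  linarith

theorem abs_sub_le_setIntegral_of_weak {a b : ℝ} (f g h : Ioo a b → ℝ) (hf : Continuous f)
    (hfi : Integrable f (timeMeasure a b)) (hg : Integrable g (timeMeasure a b))
    (hh : Integrable h (timeMeasure a b))
    (hgh : ∀ t, |g t| ≤ h t)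
    (hw : ∀ η : ℝ → ℝ, ContDiff ℝ ∞ η → HasCompactSupport η → tsupport η ⊆ Ioo a b →
      -(∫ t : Ioo a b, deriv η t * f t ∂timeMeasure a b)
        + ∫ t : Ioo a b, η t * g t ∂timeMeasure a b = 0)
    (s t : Ioo a b) (hst : s ≤ t) :
    |f t - f s| ≤ ∫ r in Ioc s t, h r ∂timeMeasure a b := by
  rw [sub_eq_neg_setIntegral_of_weak f g hf hfi hg hw s t hst, abs_neg]
  exact norm_integral_le_of_norm_le hh.integrableOn
    (Eventually.of_forall fun t => (Real.norm_eq_abs _).trans_le (hgh t))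

/-! ### Curves of measures of bounded variation -/

section Variation

variable {X : Type*} [MetricSpace X] [CompactSpace X] [MeasurableSpace X] [BorelSpace X]

theorem abs_integral_le_norm (μ : Measure X) [IsFiniteMeasure μ] (f : C(X, ℝ)) :
    |∫ x, f x ∂μ| ≤ μ.real univ * ‖f‖ := by
  simpa using! abs_integral_sub_integral_le ⟨μ, inferInstance⟩ f 0

/-- The mass bound makes the curve a finite kernel, and integrating a jointly measurable function
against a kernel is measurable in the parameter. -/
theorem measurable_integral_curve {T : Type*} [TopologicalSpace T] [SecondCountableTopology T]
    [MeasurableSpace T] [OpensMeasurableSpace T] {μ : T → Measure X}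
    (hμ : Measurable μ) {C : ℝ≥0} (hC : ∀ t, μ t univ ≤ C) {Φ : T → C(X, ℝ)}
    (hΦ : Continuous Φ) : Measurable fun t => ∫ x, Φ t x ∂μ t := by
  let κ : ProbabilityTheory.Kernel T X := ⟨μ, hμ⟩
  have : ProbabilityTheory.IsFiniteKernel κ := ⟨⟨C, ENNReal.coe_lt_top, hC⟩⟩
  have hc : Continuous fun p : T × X => Φ p.1 p.2 := by fun_prop
  exact (hc.stronglyMeasurable.integral_kernel_prod_right' (κ := κ)).measurable

theorem integrable_integral_curve {a b : ℝ} {μ : ℝ → Measure X} (hμ : Measurable μ) {C : ℝ≥0}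
    (hC : ∀ t, μ t univ ≤ C) (h0 : ∀ t ∉ Ioo a b, μ t = 0) {Φ : ℝ → C(X, ℝ)} (hΦ : Continuous Φ)
    {K : ℝ} (hK : ∀ t, ‖Φ t‖ ≤ K) : Integrable fun t => ∫ x, Φ t x ∂μ t := by
  have hi : Integrable ((Ioo a b).indicator fun _ => (C : ℝ) * K) :=
    (integrable_indicator_iff measurableSet_Ioo).2 (integrableOn_const measure_Ioo_lt_top.ne)
  refine hi.mono (measurable_integral_curve hμ hC hΦ).aestronglyMeasurable ?_
  refine Eventually.of_forall fun t => ?_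
  by_cases ht : t ∈ Ioo a b
  · rw [indicator_of_mem ht]
    have : IsFiniteMeasure (μ t) := ⟨(hC t).trans_lt ENNReal.coe_lt_top⟩
    refine (abs_integral_le_norm (μ t) (Φ t)).trans (le_trans ?_ (le_abs_self _))
    have : (μ t).real univ ≤ C := ENNReal.toReal_le_coe_of_le_coe (hC t)
    have := (norm_nonneg _).trans (hK t)
    gcongr
    exact hK t
  · simp [h0 t ht]

/-- The two integrals telescope to integrals of `v` over windows of length `h` at the two ends, each
at most `B h` in absolute value. -/
theorem integral_sub_comp_sub_le {v : ℝ → ℝ} (hv : Monotone v) {B : ℝ} (hB : ∀ t, |v t| ≤ B)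
    {a b h : ℝ} (hh : 0 < h) :
    ∫ t in a..b, (v t - v (t - h)) ≤ 2 * B * h := by
  have hi : ∀ x y, IntervalIntegrable v volume x y := fun x y => hv.intervalIntegrable
  have hsm : Monotone fun t => v (t - h) := fun x y hxy => hv (by linarith)
  rw [intervalIntegral.integral_sub (hi _ _) hsm.intervalIntegrable,
    intervalIntegral.integral_comp_sub_right]
  have h1 := intervalIntegral.integral_add_adjacent_intervals (hi a (b - h)) (hi (b - h) b)
  have h2 := intervalIntegral.integral_add_adjacent_intervals (hi (a - h) a) (hi a (b - h))
  have h3 : ∀ x, |∫ t in (x - h)..x, v t| ≤ B * h := fun x => by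
    have := intervalIntegral.norm_integral_le_of_norm_le_const (a := x - h) (b := x) (f := v)
      (C := B) fun t _ => hB t
    simpa [abs_of_pos hh] using this
  linarith [abs_le.1 (h3 a), abs_le.1 (h3 b)]

/-- Integration by parts: the time derivative of a test function, integrated along a curve of
measures, is controlled by the variation of the curve. -/
theorem integral_deriv_le_of_variation {a b : ℝ} {μ : ℝ → Measure X} (hμ : Measurable μ) {C : ℝ≥0}
    (hC : ∀ t, μ t univ ≤ C) (h0 : ∀ t ∉ Ioo a b, μ t = 0) {Φ : ℝ → C(X, ℝ)}
    (hΦ : ContDiff ℝ 1 Φ) (hcpt : HasCompactSupport Φ) (hsupp : tsupport Φ ⊆ Ioo a b)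
    {v : ℝ → ℝ} (hv : Monotone v) {B : ℝ} (hB : ∀ t, |v t| ≤ B)
    (hvar : ∀ r, ∀ s ∈ Ioo a b, ∀ t ∈ Ioo a b, s ≤ t →
      |∫ x, Φ r x ∂μ t - ∫ x, Φ r x ∂μ s| ≤ v t - v s) :
    ∫ t, ∫ x, deriv Φ t x ∂μ t ≤ 2 * B := by
  have hfin : ∀ t, IsFiniteMeasure (μ t) := fun t => ⟨(hC t).trans_lt ENNReal.coe_lt_top⟩
  have hB0 : 0 ≤ B := (abs_nonneg _).trans (hB 0)
  have hint : ∀ (t : ℝ) (f : C(X, ℝ)), Integrable f (μ t) := fun t f =>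
    f.continuous.integrable_of_hasCompactSupport (.of_compactSpace _)
  obtain ⟨K, hK⟩ := hcpt.exists_bound_of_continuous hΦ.continuous
  obtain ⟨L, hL⟩ := hΦ.lipschitzWith_of_hasCompactSupport hcpt (by simp)
  rcases (tsupport Φ).eq_empty_or_nonempty with he | hne
  · have : Φ = 0 := tsupport_eq_empty_iff.1 he
    simp [this, hB0]
  obtain ⟨α, β, hα, hβ, hαβ⟩ : ∃ α β, α ∈ tsupport Φ ∧ β ∈ tsupport Φ ∧ tsupport Φ ⊆ Icc α β :=
    ⟨_, _, hcpt.isCompact.sInf_mem hne, hcpt.isCompact.sSup_mem hne, fun t ht =>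
      ⟨csInf_le hcpt.isCompact.bddBelow ht, le_csSup hcpt.isCompact.bddAbove ht⟩⟩
  have hle : α ≤ β := (hαβ hα).2
  let h : ℕ → ℝ := fun n => 1 / ((n : ℝ) + 1)
  have hh : ∀ n, 0 < h n := fun n => by positivity
  have hh0 : Tendsto h atTop (𝓝 0) := tendsto_one_div_add_atTop_nhds_zero_nat
  -- Forward difference quotients replace the derivative; the Lipschitz constant of `Φ` bounds them
  -- uniformly, as dominated convergence requires.
  let D : ℕ → ℝ → C(X, ℝ) := fun n t => (h n)⁻¹ • (Φ (t + h n) - Φ t)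
  have hDc : ∀ n, Continuous (D n) := fun n => by
    have := hΦ.continuous
    fun_prop
  have hDL : ∀ n t, ‖D n t‖ ≤ L := fun n t => by
    rw [norm_smul, norm_inv, Real.norm_of_nonneg (hh n).le, inv_mul_le_iff₀ (hh n), mul_comm]
    simpa [dist_eq_norm, abs_of_pos (hh n)] using hL.dist_le_mul (t + h n) t
  have hlim : Tendsto (fun n => ∫ t, ∫ x, D n t x ∂μ t) atTop
      (𝓝 (∫ t, ∫ x, deriv Φ t x ∂μ t)) := by
    refine tendsto_integral_of_dominated_convergence ((Ioo a b).indicator fun _ => (C : ℝ) * L)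
      (fun n => (measurable_integral_curve hμ hC (hDc n)).aestronglyMeasurable)
      ((integrable_indicator_iff measurableSet_Ioo).2 (integrableOn_const measure_Ioo_lt_top.ne)) ?_ ?_
    · refine fun n => Eventually.of_forall fun t => ?_
      by_cases ht : t ∈ Ioo a b
      · rw [indicator_of_mem ht]
        refine (abs_integral_le_norm (μ t) (D n t)).trans ?_
        have : (μ t).real univ ≤ C := ENNReal.toReal_le_coe_of_le_coe (hC t)
        gcongr
        exact hDL n t
      · simp [h0 t ht, indicator_of_notMem ht]
    · refine Eventually.of_forall fun t => ?_
      have hd : Tendsto (fun n => D n t) atTop (𝓝 (deriv Φ t)) := by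
        have h1 : HasDerivAt Φ (deriv Φ t) t := (hΦ.differentiable (by simp) t).hasDerivAt
        refine (h1.tendsto_slope_zero).comp (tendsto_nhdsWithin_iff.2 ⟨hh0, ?_⟩)
        exact Eventually.of_forall fun n => (hh n).ne'
      rw [tendsto_iff_norm_sub_tendsto_zero] at hd ⊢
      refine squeeze_zero (fun _ => norm_nonneg _) (fun n => ?_)
        (by simpa using hd.const_mul ((μ t).real univ))
      exact abs_integral_sub_integral_le ⟨μ t, hfin t⟩ (D n t) (deriv Φ t)
  refine le_of_tendsto hlim ?_
  -- The choice `h n < α - a` keeps `t - h n` in `(a, b)` for every `t ≥ α`.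
  filter_upwards [hh0.eventually_lt_const (sub_pos.2 (hsupp hα).1)] with n hn
  have hi1 : Integrable fun t => ∫ x, Φ t x ∂μ t := integrable_integral_curve hμ hC h0
    hΦ.continuous hK
  have hi2 : Integrable fun t => ∫ x, Φ (t + h n) x ∂μ t := integrable_integral_curve hμ hC h0
    (hΦ.continuous.comp (by fun_prop)) fun t => hK _
  have hi3 : Integrable fun t => ∫ x, Φ t x ∂μ (t - h n) := by
    simpa using hi2.comp_sub_right (h n)
  have hshift : ∫ t, ∫ x, Φ (t + h n) x ∂μ t = ∫ t, ∫ x, Φ t x ∂μ (t - h n) := by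
    rw [← integral_sub_right_eq_self _ (h n)]
    simp
  have hvi : IntegrableOn (fun t => v t - v (t - h n)) (Icc α β) :=
    (hv.locallyIntegrable.integrableOn_isCompact isCompact_Icc).sub
      ((show Monotone fun t => v (t - h n) from fun x y hxy => hv (by linarith)).locallyIntegrable
        |>.integrableOn_isCompact isCompact_Icc)
  -- Translating time moves the shift from `Φ` to `μ`. The increment of `μ` is then bounded by `v t
  -- - v (t - h)` on `[α, β]`, and `Φ` vanishes elsewhere.
  calc ∫ t, ∫ x, D n t x ∂μ t
      = (h n)⁻¹ * ∫ t, (∫ x, Φ (t + h n) x ∂μ t - ∫ x, Φ t x ∂μ t) := by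
        rw [← integral_const_mul]
        congr 1
        ext t
        rw [← integral_sub (hint _ _) (hint _ _), ← integral_const_mul]
        rfl
    _ = (h n)⁻¹ * ∫ t, (∫ x, Φ t x ∂μ (t - h n) - ∫ x, Φ t x ∂μ t) := by
        rw [integral_sub hi2 hi1, hshift, integral_sub hi3 hi1]
    _ ≤ (h n)⁻¹ * ∫ t, (Icc α β).indicator (fun t => v t - v (t - h n)) t := by
        refine mul_le_mul_of_nonneg_left ?_ (inv_nonneg.2 (hh n).le)
        refine integral_mono (hi3.sub hi1) ((integrable_indicator_iff measurableSet_Icc).2 hvi)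
          fun t => ?_
        by_cases ht : t ∈ Icc α β
        · rw [indicator_of_mem ht]
          have htI : t ∈ Ioo a b := ⟨(hsupp hα).1.trans_le ht.1, ht.2.trans_lt (hsupp hβ).2⟩
          have htI' : t - h n ∈ Ioo a b :=
            ⟨by linarith [ht.1], by linarith [htI.2, hh n]⟩
          have := hvar t _ htI' _ htI (by linarith [hh n])
          rw [abs_sub_comm] at this
          exact (le_abs_self _).trans this
        · rw [indicator_of_notMem ht, image_eq_zero_of_notMem_tsupport fun h' => ht (hαβ h')]
          simp
    _ ≤ (h n)⁻¹ * (2 * B * h n) := by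
        refine mul_le_mul_of_nonneg_left ?_ (inv_nonneg.2 (hh n).le)
        rw [integral_indicator measurableSet_Icc, integral_Icc_eq_integral_Ioc,
          ← intervalIntegral.integral_of_le hle]
        exact integral_sub_comp_sub_le hv hB (hh n)
    _ = 2 * B := by
        field_simp [(hh n).ne']

end Variation

/-! ### Cubes in the torus and the embedding of discrete measures -/

/-- The projection `ℝ^d → 𝕋^d`. -/
def torusMk {d : ℕ} (w : Fin d → ℝ) : Torus d := fun i => (w i : UnitAddCircle)

theorem norm_torusMk_le {d : ℕ} (w : Fin d → ℝ) : ‖torusMk w‖ ≤ ‖w‖ :=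
  (pi_norm_le_iff_of_nonneg (norm_nonneg _)).2 fun i =>
    (QuotientAddGroup.norm_mk_le_norm).trans (norm_le_pi_norm w i)

theorem coe_mesh (N : ℕ) : (mesh N : ℝ) = 1 / N := by simp [mesh]

theorem mesh_pos (N : ℕ) [NeZero N] : 0 < mesh N := by
  have := NeZero.pos N
  unfold mesh
  positivity

theorem mesh_le_one (N : ℕ) [NeZero N] : (mesh N : ℝ) ≤ 1 := by
  rw [coe_mesh, div_le_one (by exact_mod_cast NeZero.pos N)]
  exact_mod_cast NeZero.one_le

/-- The corner of the cube `Q_ε^z`. -/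
noncomputable def corner {d : ℕ} (N : ℕ) (z : Fin d → ZMod N) : Torus d :=
  torusMk fun i => (mesh N : ℝ) * (z i).val

/-- Representatives modulo `N` add up to a multiple of `N`, which becomes an integer after scaling
by `1 / N` and vanishes in the circle. -/
theorem corner_add_intCast {d : ℕ} (N : ℕ) [NeZero N] (z : Fin d → ZMod N) (w : Fin d → ℤ) :
    corner N (fun i => z i + (w i : ZMod N)) =
      corner N z + torusMk fun i => (mesh N : ℝ) * w i := by
  have hN : (N : ℝ) ≠ 0 := Nat.cast_ne_zero.2 (NeZero.ne N)
  ext i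
  change (((mesh N : ℝ) * ((z i + (w i : ZMod N)).val : ℝ) : ℝ) : UnitAddCircle) =
    ((((mesh N : ℝ) * ((z i).val : ℝ)) + (mesh N : ℝ) * w i : ℝ) : UnitAddCircle)
  have h : (((z i).val + w i : ℤ) : ZMod N) = (((z i + (w i : ZMod N)).val : ℤ) : ZMod N) := by
    simp
  obtain ⟨k, hk⟩ := (ZMod.intCast_eq_intCast_iff_dvd_sub _ _ _).1 h
  rw [← sub_eq_zero, ← AddCircle.coe_sub, AddCircle.coe_eq_zero_iff]
  refine ⟨k, ?_⟩
  have hk' : (((z i + (w i : ZMod N)).val : ℝ)) - ((z i).val + w i) = N * k := by exact_mod_cast hk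
  rw [← mul_add, ← mul_sub, hk', coe_mesh]
  field_simp
  simp

/-- The half-open arc `[0, ε)` in the circle. -/
def arc (N : ℕ) : Set UnitAddCircle := (fun r : ℝ => (r : UnitAddCircle)) '' Ico 0 (mesh N)

theorem injOn_coe_unitAddCircle : InjOn (fun r : ℝ => (r : UnitAddCircle)) (Ico 0 1) := by
  intro x hx y hy h
  have h01 : Ico (0:ℝ) 1 = Ico 0 (0 + 1) := by simp
  rw [h01] at hx hy
  exact (AddCircle.coe_eq_coe_iff_of_mem_Ico hx hy).1 h

theorem measurableSet_arc (N : ℕ) [NeZero N] : MeasurableSet (arc N) :=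
  measurableSet_Ico.image_of_continuousOn_injOn (AddCircle.continuous_mk' 1).continuousOn
    (injOn_coe_unitAddCircle.mono (Ico_subset_Ico_right (mesh_le_one N)))

theorem volume_arc (N : ℕ) [NeZero N] : volume (arc N) = mesh N := by
  rw [← (UnitAddCircle.measurePreserving_mk 0).measure_preimage
    (measurableSet_arc N).nullMeasurableSet, Measure.restrict_apply
    ((AddCircle.measurable_mk') (measurableSet_arc N))]
  -- The fundamental domain is `Ioc`, the arc is an image of `Ico`; the mismatch is confined to the
  -- points `0` and `1`.
  have : (QuotientAddGroup.mk ⁻¹' arc N ∩ Ioc (0:ℝ) (0 + 1) : Set ℝ) =ᵐ[volume]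
      Ico (0:ℝ) (mesh N) := by
    have h0 : ∀ᵐ r : ℝ, r ≠ 0 := by simp [ae_iff, measure_singleton]
    have h1 : ∀ᵐ r : ℝ, r ≠ 1 := by simp [ae_iff, measure_singleton]
    filter_upwards [h0, h1] with r hr0 hr1
    apply propext
    change (((r : UnitAddCircle) ∈ arc N) ∧ r ∈ Ioc (0:ℝ) (0 + 1)) ↔ r ∈ Ico (0:ℝ) (mesh N)
    rw [zero_add]
    constructor
    · rintro ⟨⟨s, hs, hsr⟩, hr⟩
      have := injOn_coe_unitAddCircle (Ico_subset_Ico_right (mesh_le_one N) hs)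
        ⟨hr.1.le, lt_of_le_of_ne hr.2 hr1⟩ hsr
      exact this ▸ hs
    · exact fun hr => ⟨⟨r, hr, rfl⟩, lt_of_le_of_ne hr.1 (Ne.symm hr0),
        hr.2.le.trans (mesh_le_one N)⟩
  rw [measure_congr this, Real.volume_Ico, sub_zero, ENNReal.ofReal_coe_nnreal]

/-- All cubes are translates of one product of arcs, so averages over different cubes become
integrals over a common domain. -/
theorem cube_eq_preimage {d : ℕ} (N : ℕ) (z : Fin d → ZMod N) :
    cube N z = (fun x => x + (-corner N z)) ⁻¹' (Set.pi univ fun _ => arc N) := by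
  ext x
  simp only [cube, mem_image, mem_ofPred_eq, mem_preimage, Set.mem_pi, mem_univ, true_imp_iff]
  constructor
  · rintro ⟨w, hw, rfl⟩ i
    refine ⟨w i - (mesh N : ℝ) * ((z i).val : ℝ), ⟨by linarith [(hw i).1], by linarith [(hw i).2]⟩, ?_⟩
    exact (AddCircle.coe_sub _ _ _).trans (sub_eq_add_neg _ _)
  · intro h
    choose w hw hwx using h
    refine ⟨fun i => w i + (mesh N : ℝ) * ((z i).val : ℝ), fun i => ⟨by linarith [(hw i).1],
      by linarith [(hw i).2]⟩, ?_⟩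
    ext i
    have := hwx i
    simp only [Pi.add_apply, Pi.neg_apply] at this
    simp only [AddCircle.coe_add, this, corner, torusMk]
    abel

theorem measurableSet_pi_arc (d N : ℕ) [NeZero N] :
    MeasurableSet (Set.pi univ fun _ : Fin d => arc N) :=
  MeasurableSet.univ_pi fun _ => measurableSet_arc N

theorem volume_pi_arc (d N : ℕ) [NeZero N] :
    volume (Set.pi univ fun _ : Fin d => arc N) = (mesh N : ℝ≥0∞) ^ d := by
  rw [volume_pi_pi]
  simp [volume_arc]

/-- The average of a function over the cube `Q_ε^z`. -/
noncomputable def cubeAvg {d : ℕ} (N : ℕ) (ψ : Torus d → ℝ) (z : Fin d → ZMod N) : ℝ :=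
  ((mesh N : ℝ) ^ d)⁻¹ * ∫ x in cube N z, ψ x

theorem cubeAvg_eq {d : ℕ} (N : ℕ) (ψ : Torus d → ℝ) (z : Fin d → ZMod N) :
    cubeAvg N ψ z = ((mesh N : ℝ) ^ d)⁻¹ *
      ∫ x in Set.pi univ fun _ : Fin d => arc N, ψ (x + corner N z) := by
  rw [cubeAvg, cube_eq_preimage]
  have := (measurePreserving_add_right (volume : Measure (Torus d))
    (-corner N z)).setIntegral_preimage_emb (measurableEmbedding_addRight _)
    (fun x => ψ (x + corner N z)) (Set.pi univ fun _ : Fin d => arc N)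
  simp only [neg_add_cancel_right] at this
  rw [this]

theorem volume_cube {d : ℕ} (N : ℕ) [NeZero N] (z : Fin d → ZMod N) :
    volume (cube N z) = (mesh N : ℝ≥0∞) ^ d := by
  rw [cube_eq_preimage, (measurePreserving_add_right (volume : Measure (Torus d))
    (-corner N z)).measure_preimage (measurableSet_pi_arc d N).nullMeasurableSet, volume_pi_arc]

/-- The oscillation of a cube average under a translation of the cube. -/
theorem abs_cubeAvg_sub_le {d : ℕ} (N : ℕ) [NeZero N] {ψ : Torus d → ℝ} (hψ : Continuous ψ)
    {K : ℝ} (hK : ∀ x w, |ψ (x + torusMk w) - ψ x| ≤ K * ‖w‖) (z : Fin d → ZMod N)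
    (w : Fin d → ℤ) :
    |cubeAvg N ψ (fun i => z i + (w i : ZMod N)) - cubeAvg N ψ z| ≤ K * (mesh N * ‖w‖) := by
  have hm := mesh_pos N
  have hm' : (0 : ℝ) < (mesh N : ℝ) ^ d := by positivity
  have hi : ∀ c : Torus d, IntegrableOn (fun x => ψ (x + c))
      (Set.pi univ fun _ : Fin d => arc N) := fun c =>
    ((hψ.comp (by fun_prop)).integrable_of_hasCompactSupport (.of_compactSpace _)).integrableOn
  rw [cubeAvg_eq, cubeAvg_eq, ← mul_sub, ← integral_sub (hi _) (hi _), abs_mul, abs_inv,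
    abs_of_pos hm', inv_mul_le_iff₀ hm']
  have hw : ‖fun i => (mesh N : ℝ) * w i‖ = mesh N * ‖w‖ := by
    have : (fun i => (mesh N : ℝ) * w i) = (mesh N : ℝ) • fun i => (w i : ℝ) := rfl
    rw [this, norm_smul, Real.norm_of_nonneg (NNReal.coe_nonneg _)]
    rfl
  have hb := norm_setIntegral_le_of_norm_le_const
    (μ := (volume : Measure (Torus d))) (s := Set.pi univ fun _ : Fin d => arc N)
    (f := fun x => ψ (x + corner N (fun i => z i + (w i : ZMod N))) - ψ (x + corner N z))
    (C := K * (mesh N * ‖w‖)) (measure_lt_top _ _) fun x _ => by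
      rw [corner_add_intCast, ← add_assoc, ← hw]
      exact hK _ _
  refine hb.trans_eq ?_
  rw [mul_comm, measureReal_def, volume_pi_arc]
  simp

theorem embed_apply_univ {d : ℕ} {V : Type*} [Fintype V] {N : ℕ} [NeZero N]
    (m : RVertex d N V → ℝ≥0) : embed m univ = ∑ x, (m x : ℝ≥0∞) := by
  have hm := mesh_pos N
  simp only [embed, Measure.smul_apply, Measure.finsetSum_apply, Measure.restrict_apply_univ,
    volume_cube]
  simp only [ENNReal.smul_def, smul_eq_mul, Finset.mul_sum]
  refine Finset.sum_congr rfl fun x _ => ?_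
  norm_cast
  field_simp

instance {d : ℕ} {V : Type*} [Fintype V] {N : ℕ} [NeZero N] (m : RVertex d N V → ℝ≥0) :
    IsFiniteMeasure (embed m) := by
  constructor
  rw [embed_apply_univ]
  exact ENNReal.sum_lt_top.2 fun _ _ => ENNReal.coe_lt_top

/-- This turns a test function on the torus into a function on the vertices, against which the
discrete continuity equation can be tested. -/
theorem integral_embed {d : ℕ} {V : Type*} [Fintype V] {N : ℕ} [NeZero N]
    (m : RVertex d N V → ℝ≥0) {ψ : Torus d → ℝ} (hψ : Continuous ψ) :
    ∫ x, ψ x ∂embed m = ∑ x, (m x : ℝ) * cubeAvg N ψ x.1 := by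
  have hi : ∀ μ : Measure (Torus d), IsFiniteMeasure μ → Integrable ψ μ := fun μ _ =>
    hψ.integrable_of_hasCompactSupport (.of_compactSpace _)
  rw [embed, integral_smul_nnreal_measure, integral_finsetSum_measure fun x _ => hi _ inferInstance,
    Finset.smul_sum]
  refine Finset.sum_congr rfl fun x _ => ?_
  rw [integral_smul_nnreal_measure, cubeAvg, NNReal.smul_def, NNReal.smul_def, smul_eq_mul,
    smul_eq_mul]
  push_cast
  ring

/-! ### Edges of the periodic graph and of its rescalings -/

section Graph

variable {d : ℕ} {V : Type*}

theorem PeriodicGraph.shift_mem (G : PeriodicGraph d V) {e : Vertex d V × Vertex d V}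
    (he : e ∈ G.edges) : (((0 : Fin d → ℤ), e.1.2), (e.2.1 - e.1.1, e.2.2)) ∈ G.edges := by
  have := (G.periodic (-e.1.1) e.1 e.2).1 he
  simpa [shift, neg_add_eq_sub] using this

theorem PeriodicGraph.finite_edges_zero [Finite V] (G : PeriodicGraph d V) :
    {e | e ∈ G.edges ∧ e.1.1 = 0}.Finite := by
  obtain ⟨D, hD⟩ := G.boundedDegree
  have hfin : ∀ x, {y | (x, y) ∈ G.edges}.Finite := fun x =>
    finite_of_encard_le_coe (hD x)
  have : (⋃ v : V, (Prod.mk ((0 : Fin d → ℤ), v)) '' {y | (((0 : Fin d → ℤ), v), y) ∈ G.edges}).Finite :=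
    finite_iUnion fun v => (hfin _).image _
  refine this.subset ?_
  rintro ⟨⟨z, v⟩, y⟩ ⟨he, hz⟩
  obtain rfl : z = 0 := hz
  exact mem_iUnion.2 ⟨v, y, he, rfl⟩

/-- The supremum is a genuine one: by periodicity all edge lengths occur among the finitely many
edges starting in the cell at the origin. -/
theorem PeriodicGraph.norm_sub_le_maxEdgeLength [Finite V] (G : PeriodicGraph d V)
    {e : Vertex d V × Vertex d V} (he : e ∈ G.edges) : ‖e.1.1 - e.2.1‖ ≤ G.maxEdgeLength := by
  refine le_csSup ?_ (mem_image_of_mem _ he)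
  refine (G.finite_edges_zero.image fun e => ‖e.1.1 - e.2.1‖).bddAbove.mono ?_
  rintro _ ⟨e, he, rfl⟩
  exact ⟨_, ⟨G.shift_mem he, rfl⟩, by simp⟩

theorem PeriodicGraph.maxEdgeLength_nonneg (G : PeriodicGraph d V) : 0 ≤ G.maxEdgeLength := by
  refine Real.sSup_nonneg ?_
  rintro _ ⟨e, -, rfl⟩
  exact norm_nonneg _

noncomputable instance [Fintype V] (G : PeriodicGraph d V) (N : ℕ) [NeZero N] :
    Fintype (G.redges N) := Fintype.ofFinite _

/-- Every rescaled edge is the image of an edge starting in the cell at the origin. -/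
theorem PeriodicGraph.exists_wrap_eq (G : PeriodicGraph d V) (N : ℕ) (e : G.redges N) :
    ∃ (z : Fin d → ZMod N) (e' : Vertex d V × Vertex d V), e' ∈ G.edges ∧ e'.1.1 = 0 ∧
      (e : RVertex d N V × RVertex d N V) = (wrap N z e'.1, wrap N z e'.2) := by
  obtain ⟨_, e, he, rfl⟩ := e
  exact ⟨fun i => (e.1.1 i : ZMod N), _, G.shift_mem he, rfl, by simp [wrap]⟩

/-- The total variation of a flux. -/
noncomputable def fluxNorm [Fintype V] {G : PeriodicGraph d V} {N : ℕ} [NeZero N]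
    (J : Flux (G.redges N)) : ℝ :=
  ∑ e, |(J : G.redges N → ℝ) e|

theorem fluxNorm_nonneg [Fintype V] {G : PeriodicGraph d V} {N : ℕ} [NeZero N]
    (J : Flux (G.redges N)) : 0 ≤ fluxNorm J :=
  Finset.sum_nonneg fun _ _ => abs_nonneg _

theorem divergence_eq_sum {X : Type*} [DecidableEq X] {E : Set (X × X)} [Fintype E] (J : Flux E)
    (x : X) :
    divergence J x = ∑ e : E, if (e : X × X).1 = x then (J : E → ℝ) e else 0 := by
  rw [divergence, finsum_eq_sum_of_fintype]
  refine Finset.sum_congr rfl fun e _ => ?_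
  split_ifs with h <;> simp [h]

theorem abs_divergence_le [Fintype V] {G : PeriodicGraph d V} {N : ℕ} [NeZero N]
    (J : Flux (G.redges N)) (x : RVertex d N V) : |divergence J x| ≤ fluxNorm J := by
  classical
  rw [divergence_eq_sum]
  refine (Finset.abs_sum_le_sum_abs _ _).trans (Finset.sum_le_sum fun e _ => ?_)
  split_ifs <;> simp

/-- Discrete integration by parts, with a bound. -/
theorem abs_sum_mul_divergence_le [Fintype V] {G : PeriodicGraph d V} {N : ℕ} [NeZero N]
    (J : Flux (G.redges N)) (A : (Fin d → ZMod N) → ℝ) {δ : ℝ}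
    (hA : ∀ e ∈ G.redges N, |A e.1.1 - A e.2.1| ≤ δ) :
    |∑ x : RVertex d N V, A x.1 * divergence J x| ≤ δ * fluxNorm J := by
  classical
  let S := ∑ e : G.redges N, A e.1.1.1 * (J : G.redges N → ℝ) e
  have h1 : ∑ x : RVertex d N V, A x.1 * divergence J x = S := by
    simp only [divergence_eq_sum, Finset.mul_sum, S]
    rw [Finset.sum_comm]
    refine Finset.sum_congr rfl fun e _ => ?_
    simp
  have hsymm : ∀ e ∈ G.redges N, e.swap ∈ G.redges N := by
    rintro _ ⟨e, he, rfl⟩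
    exact ⟨e.swap, G.symm _ _ he, rfl⟩
  let σ : Equiv.Perm (G.redges N) :=
    { toFun := fun e => ⟨e.1.swap, hsymm _ e.2⟩
      invFun := fun e => ⟨e.1.swap, hsymm _ e.2⟩
      left_inv := fun e => by simp
      right_inv := fun e => by simp }
  -- Reversing every edge changes the sign of the flux. Averaging the two expressions for `S`
  -- produces differences of `A` along edges; the resulting factor `1/2` is dropped at the end.
  have h2 : S = -∑ e : G.redges N, A e.1.2.1 * (J : G.redges N → ℝ) e := by
    rw [← Finset.sum_neg_distrib, ← Equiv.sum_comp σ]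
    refine Finset.sum_congr rfl fun e _ => ?_
    rw [J.2 e (σ e) rfl]
    simp [σ]
  have h3 : S + S = ∑ e : G.redges N, (A e.1.1.1 - A e.1.2.1) * (J : G.redges N → ℝ) e := by
    nth_rewrite 2 [h2]
    simp only [S, sub_eq_add_neg, add_mul, neg_mul,
      Finset.sum_add_distrib, Finset.sum_neg_distrib]
  have h4 : |S + S| ≤ δ * fluxNorm J := by
    rw [h3, fluxNorm, Finset.mul_sum]
    refine (Finset.abs_sum_le_sum_abs _ _).trans (Finset.sum_le_sum fun e _ => ?_)
    rw [abs_mul]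
    exact mul_le_mul_of_nonneg_right (hA _ e.2) (abs_nonneg _)
  rw [h1]
  rw [← two_mul, abs_mul, abs_two] at h4
  linarith [abs_nonneg S]

/-- An edge of the torus graph lifts to an edge of the periodic graph, so its two cubes differ by a
translation of length at most `ε R₀`. -/
theorem abs_cubeAvg_edge_sub_le [Finite V] (G : PeriodicGraph d V) (N : ℕ) [NeZero N]
    {ψ : Torus d → ℝ} (hψ : Continuous ψ) {K : ℝ} (hK0 : 0 ≤ K)
    (hK : ∀ x w, |ψ (x + torusMk w) - ψ x| ≤ K * ‖w‖) (e : RVertex d N V × RVertex d N V)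
    (he : e ∈ G.redges N) :
    |cubeAvg N ψ e.1.1 - cubeAvg N ψ e.2.1| ≤ K * (mesh N * G.maxEdgeLength) := by
  obtain ⟨z, e', he', h0, hee⟩ := G.exists_wrap_eq N ⟨e, he⟩
  obtain rfl : e = _ := hee
  have h1 : (wrap N z e'.1).1 = z := by
    ext i
    simp [wrap, h0]
  rw [abs_sub_comm, h1]
  refine (abs_cubeAvg_sub_le N hψ hK z e'.2.1).trans ?_
  have := G.norm_sub_le_maxEdgeLength he'
  rw [h0, zero_sub, norm_neg] at this
  gcongr

/-! ### The growth condition for the rescaled energy -/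

theorem sum_le_sum_of_surjective {α β : Type*} [Fintype α] [Fintype β] {g : α → β}
    (hg : Function.Surjective g) (f : β → ℝ) (hf : ∀ b, 0 ≤ f b) : ∑ b, f b ≤ ∑ a, f (g a) := by
  classical
  obtain ⟨s, hs⟩ := hg.hasRightInverse
  calc ∑ b, f b = ∑ b, f (g (s b)) := by simp only [hs _]
    _ = ∑ a ∈ Finset.univ.image s, f (g a) :=
      (Finset.sum_image (f := fun a => f (g a)) fun _ _ _ _ h => hs.injective h).symm
    _ ≤ ∑ a, f (g a) := Finset.sum_le_univ_sum_of_nonneg fun _ => hf _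

theorem sum_wrap_le [Fintype V] (N : ℕ) [NeZero N] (m : RVertex d N V → ℝ≥0) (x : Vertex d V) :
    ∑ z : Fin d → ZMod N, (m (wrap N z x) : ℝ) ≤ ∑ y, (m y : ℝ) := by
  classical
  have hinj : Function.Injective fun z : Fin d → ZMod N => wrap N z x := fun z z' h => by
    ext i
    simpa [wrap] using congrFun (congrArg Prod.fst h) i
  calc ∑ z : Fin d → ZMod N, (m (wrap N z x) : ℝ)
      = ∑ y ∈ Finset.univ.image fun z : Fin d → ZMod N => wrap N z x, (m y : ℝ) :=
        (Finset.sum_image (f := fun y => (m y : ℝ)) fun _ _ _ _ h => hinj h).symm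
    _ ≤ ∑ y, (m y : ℝ) := Finset.sum_le_univ_sum_of_nonneg fun _ => NNReal.coe_nonneg _

theorem finite_vertices_norm_le [Finite V] (R : ℝ) : {x : Vertex d V | ‖x.1‖ ≤ R}.Finite := by
  have h : {z : Fin d → ℤ | ‖z‖ ≤ R}.Finite := by
    have := (isCompact_closedBall (0 : Fin d → ℤ) R).finite_of_discrete
    simpa [Metric.closedBall, Set.ofPred] using this
  exact (h.prod finite_univ).subset fun x hx => ⟨hx, mem_univ _⟩

theorem coe_finset_sum_ereal {α : Type*} (s : Finset α) (f : α → ℝ) :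
    ((∑ x ∈ s, f x : ℝ) : EReal) = ∑ x ∈ s, (f x : EReal) := by
  classical
  induction s using Finset.induction_on with
  | empty => simp
  | insert a s ha ih => rw [Finset.sum_insert ha, Finset.sum_insert ha, EReal.coe_add, ih]

/-- The rescaled energy grows at least linearly in the flux, uniformly in the mesh size. -/
theorem AdmissibleCost.exists_le_energy [Fintype V] {G : PeriodicGraph d V}
    {F : (Vertex d V → ℝ≥0) × Flux G.edges → EReal} (hF : AdmissibleCost G F) :
    ∃ c K : ℝ, 0 < c ∧ 0 ≤ K ∧ ∀ (N : ℕ) [NeZero N] (m : RVertex d N V → ℝ≥0)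
      (J : Flux (G.redges N)),
      ((c * (mesh N * fluxNorm J) - K * (1 + ∑ x, (m x : ℝ)) : ℝ) : EReal) ≤ energy G F N m J := by
  obtain ⟨R₁, -, c, C, hc, hgrowth⟩ := hF.local_growth
  let E₀ : Finset G.edges := (G.finite_edges_zero.preimage (f := ((↑) : G.edges → _))
    Subtype.val_injective.injOn).toFinset
  let B : Finset (Vertex d V) := (finite_vertices_norm_le (max G.maxEdgeLength R₁)).toFinset
  -- The `1` accounts for `∑ ε^d = 1`, and `B.card` for the number of cells that see a given vertex.
  -- The absolute value is needed as `C` may be negative.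
  refine ⟨c, |C| * (1 + B.card), hc, by positivity, fun N _ m J => ?_⟩
  have hm := mesh_pos N
  have hε : (0 : ℝ) < mesh N := hm
  have hE₀ : ∀ f : G.edges → ℝ, ∑ᶠ (e : G.edges) (_ : e.1.1.1 = 0), f e = ∑ e ∈ E₀, f e := fun f =>
    finsum_cond_eq_sum_of_cond_iff f fun {e} _ => by simp [E₀]
  have hB : ∀ f : Vertex d V → ℝ,
      ∑ᶠ (x : Vertex d V) (_ : ‖x.1‖ ≤ max G.maxEdgeLength R₁), f x = ∑ x ∈ B, f x := fun f =>
    finsum_cond_eq_sum_of_cond_iff f fun {x} _ => by simp [B]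
  have hz : ∀ z : Fin d → ZMod N,
      ((c * mesh N * (∑ e ∈ E₀, |(pullFlux G z J : G.edges → ℝ) e|)
        - |C| * ((mesh N : ℝ) ^ d + ∑ x ∈ B, (m (wrap N z x) : ℝ)) : ℝ) : EReal) ≤
      (((mesh N ^ d : ℝ≥0) : ℝ) : EReal) *
        F ((mesh N ^ d)⁻¹ • pullMass z m, (mesh N ^ ((d : ℤ) - 1))⁻¹ • pullFlux G z J) := by
    intro z
    refine le_trans ?_ (mul_le_mul_of_nonneg_left
      (hgrowth ((mesh N ^ d)⁻¹ • pullMass z m) ((mesh N ^ ((d : ℤ) - 1))⁻¹ • pullFlux G z J))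
      (EReal.coe_nonneg.2 (NNReal.coe_nonneg _)))
    rw [← EReal.coe_mul, EReal.coe_le_coe_iff, hE₀, hB]
    have e1 : ∑ e ∈ E₀, |(((mesh N ^ ((d : ℤ) - 1))⁻¹ • pullFlux G z J : Flux G.edges) :
        G.edges → ℝ) e| = ((mesh N : ℝ) ^ ((d : ℤ) - 1))⁻¹ *
          ∑ e ∈ E₀, |(pullFlux G z J : G.edges → ℝ) e| := by
      rw [Finset.mul_sum]
      refine Finset.sum_congr rfl fun e _ => ?_
      have : (((mesh N ^ ((d : ℤ) - 1))⁻¹ • pullFlux G z J : Flux G.edges) : G.edges → ℝ) e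
        = ((mesh N : ℝ) ^ ((d : ℤ) - 1))⁻¹ * (pullFlux G z J : G.edges → ℝ) e := by
          change (((mesh N ^ ((d : ℤ) - 1))⁻¹ : ℝ≥0) : ℝ) * _ = _
          push_cast
          rfl
      rw [this, abs_mul, abs_of_pos (by positivity)]
    have e2 : ∑ x ∈ B, ((((mesh N ^ d)⁻¹ • pullMass z m) x : ℝ≥0) : ℝ) =
        ((mesh N : ℝ) ^ d)⁻¹ * ∑ x ∈ B, (m (wrap N z x) : ℝ) := by
      rw [Finset.mul_sum]
      refine Finset.sum_congr rfl fun x _ => ?_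
      change (((mesh N ^ d)⁻¹ * m (wrap N z x) : ℝ≥0) : ℝ) = _
      push_cast
      rfl
    rw [e1, e2]
    set S := ∑ e ∈ E₀, |(pullFlux G z J : G.edges → ℝ) e|
    set T := ∑ x ∈ B, (m (wrap N z x) : ℝ)
    have hT : 0 ≤ T := Finset.sum_nonneg fun _ _ => NNReal.coe_nonneg _
    push_cast
    have e3 : (mesh N : ℝ) ^ d * (c * (((mesh N : ℝ) ^ ((d : ℤ) - 1))⁻¹ * S)
        - C * (1 + ((mesh N : ℝ) ^ d)⁻¹ * T)) = c * mesh N * S - C * ((mesh N : ℝ) ^ d + T) := by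
      rw [zpow_sub_one₀ hε.ne', zpow_natCast]
      field_simp
    rw [e3]
    have : C * ((mesh N : ℝ) ^ d + T) ≤ |C| * ((mesh N : ℝ) ^ d + T) :=
      mul_le_mul_of_nonneg_right (le_abs_self C) (by positivity)
    linarith
  -- Each rescaled edge is hit at least once by a translate of an edge from the cell at the origin;
  -- multiple hits only help.
  have hJ : fluxNorm J ≤ ∑ z : Fin d → ZMod N, ∑ e ∈ E₀, |(pullFlux G z J : G.edges → ℝ) e| := by
    let g : (Fin d → ZMod N) × E₀ → G.redges N := fun p =>
      ⟨(wrap N p.1 p.2.1.1.1, wrap N p.1 p.2.1.1.2), G.wrap_mem N p.1 p.2.1.1 p.2.1.2⟩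
    have hg : Function.Surjective g := fun e => by
      obtain ⟨z, e', he', h0, hee⟩ := G.exists_wrap_eq N e
      exact ⟨(z, ⟨⟨e', he'⟩, by simp [E₀, h0]⟩), Subtype.ext hee.symm⟩
    refine (sum_le_sum_of_surjective hg (fun e => |(J : G.redges N → ℝ) e|)
      fun e => abs_nonneg _).trans_eq ?_
    rw [Fintype.sum_prod_type]
    refine Finset.sum_congr rfl fun z _ => ?_
    exact Finset.sum_coe_sort E₀ fun e => |(pullFlux G z J : G.edges → ℝ) e|
  have hM : ∑ z : Fin d → ZMod N, ∑ x ∈ B, (m (wrap N z x) : ℝ) ≤ B.card * ∑ y, (m y : ℝ) := by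
    rw [Finset.sum_comm, ← nsmul_eq_mul]
    exact Finset.sum_le_card_nsmul _ _ _ fun x _ => sum_wrap_le N m x
  have hone : ∑ _z : Fin d → ZMod N, (mesh N : ℝ) ^ d = 1 := by
    have : (N : ℝ) ≠ 0 := Nat.cast_ne_zero.2 (NeZero.ne N)
    simp [coe_mesh, ZMod.card, this]
  refine le_trans ?_ (Finset.sum_le_sum fun z _ => hz z)
  rw [← coe_finset_sum_ereal, EReal.coe_le_coe_iff, Finset.sum_sub_distrib, ← Finset.mul_sum,
    ← Finset.mul_sum, Finset.sum_add_distrib, hone]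
  have hMnn : 0 ≤ ∑ y, (m y : ℝ) := Finset.sum_nonneg fun _ _ => NNReal.coe_nonneg _
  have k1 := mul_le_mul_of_nonneg_left hJ (show 0 ≤ c * (mesh N : ℝ) by positivity)
  have k2 := mul_le_mul_of_nonneg_left hM (abs_nonneg C)
  have k3 : 0 ≤ |C| * (B.card + ∑ y, (m y : ℝ)) := by positivity
  nlinarith

end Graph

/-! ### Flux bounds from the action -/

/-- The lower bound on `E`, rearranged without subtraction, so that it can be integrated in `ℝ≥0∞`
even where `E` is infinite. -/
theorem ofReal_add_toENNReal_neg_le {x y : ℝ} (hx : 0 ≤ x) (hy : 0 ≤ y) {E : EReal}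
    (h : ((x - y : ℝ) : EReal) ≤ E) :
    ENNReal.ofReal x + (-E).toENNReal ≤ E.toENNReal + ENNReal.ofReal y := by
  induction E with
  | bot => exact absurd (le_bot_iff.1 h) (EReal.coe_ne_bot _)
  | top => simp
  | coe r =>
    rw [EReal.coe_le_coe_iff] at h
    rw [← EReal.coe_neg, EReal.toENNReal_of_ne_top (EReal.coe_ne_top _),
      EReal.toENNReal_of_ne_top (EReal.coe_ne_top _), EReal.toReal_coe, EReal.toReal_coe]
    rcases le_total 0 r with hr | hr
    · rw [ENNReal.ofReal_of_nonpos (neg_nonpos.2 hr), add_zero, ← ENNReal.ofReal_add hr hy]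
      exact ENNReal.ofReal_le_ofReal (by linarith)
    · rw [ENNReal.ofReal_of_nonpos hr, zero_add]
      rw [← ENNReal.ofReal_add hx (neg_nonneg.2 hr)]
      exact ENNReal.ofReal_le_ofReal (by linarith)

/-- The negative part of `E` is at most `g`, so its integral is finite and cancels. Additivity of
the integral is applied only with `f` or `g` as the measurable summand, so `E` can be arbitrary. -/
theorem lintegral_le_of_erealIntegral_lt {α : Type*} [MeasurableSpace α] {μ : Measure α}
    {E : α → EReal} {f g : α → ℝ} (hf : Measurable f) (hg : Measurable g) (hf0 : ∀ t, 0 ≤ f t)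
    (hg0 : ∀ t, 0 ≤ g t) (h : ∀ t, ((f t - g t : ℝ) : EReal) ≤ E t) {A : ℝ}
    (hA : erealIntegral μ E < A) (hgi : ∫⁻ t, ENNReal.ofReal (g t) ∂μ ≠ ⊤) :
    ∫⁻ t, ENNReal.ofReal (f t) ∂μ ≤ ENNReal.ofReal A + ∫⁻ t, ENNReal.ofReal (g t) ∂μ := by
  have hpt := fun t => ofReal_add_toENNReal_neg_le (hf0 t) (hg0 t) (h t)
  have h1 := lintegral_mono (μ := μ) hpt
  rw [lintegral_add_left hf.ennreal_ofReal, lintegral_add_right _ hg.ennreal_ofReal] at h1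
  have h2 : ∫⁻ t, (-E t).toENNReal ∂μ ≤ ∫⁻ t, ENNReal.ofReal (g t) ∂μ := by
    refine lintegral_mono fun t => ?_
    have : -E t ≤ (g t : EReal) := by
      rw [EReal.neg_le]
      refine le_trans ?_ (h t)
      rw [← EReal.coe_neg, EReal.coe_le_coe_iff]
      linarith [hf0 t]
    refine (EReal.toENNReal_le_toENNReal this).trans_eq ?_
    rw [EReal.toENNReal_of_ne_top (EReal.coe_ne_top _), EReal.toReal_coe]
  unfold erealIntegral at hA
  set P := ∫⁻ t, (E t).toENNReal ∂μ
  set Q := ∫⁻ t, (-E t).toENNReal ∂μ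
  have hQ : Q ≠ ⊤ := ne_top_of_le_ne_top hgi h2
  have h3 : P ≤ ENNReal.ofReal A + Q := by
    lift Q to ℝ≥0 using hQ with q
    rw [EReal.sub_lt_iff (Or.inl (by simp)) (Or.inl (by simp))] at hA
    rw [← EReal.coe_ennreal_le_coe_ennreal_iff, EReal.coe_ennreal_add, EReal.coe_ennreal_ofReal]
    refine hA.le.trans ?_
    gcongr
    exact le_max_left _ _
  have h4 : ∫⁻ t, ENNReal.ofReal (f t) ∂μ + Q ≤
      (ENNReal.ofReal A + ∫⁻ t, ENNReal.ofReal (g t) ∂μ) + Q := by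
    refine h1.trans ?_
    rw [add_right_comm]
    gcongr
  exact (ENNReal.add_le_add_iff_right hQ).1 h4

section Level

variable {d : ℕ} {V : Type*} [Fintype V]

/-- Curves of bounded action and mass have a uniformly bounded variation, in duality with
Lipschitz functions. -/
theorem AdmissibleCost.exists_variation_bound {G : PeriodicGraph d V}
    {F : (Vertex d V → ℝ≥0) × Flux G.edges → EReal} (hF : AdmissibleCost G F) (a b A : ℝ)
    (M : ℝ≥0) :
    ∃ B : ℝ, ∀ (N : ℕ) [NeZero N] (m : Ioo a b → RVertex d N V → ℝ≥0),
      action G F N a b m < A → totalMass N a b m ≤ M →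
      Continuous m ∧ ∃ h : Ioo a b → ℝ, Integrable h (timeMeasure a b) ∧ (∀ t, 0 ≤ h t) ∧
        ∫ t, h t ∂timeMeasure a b ≤ B ∧
        ∀ ψ : Torus d → ℝ, Continuous ψ → ∀ K : ℝ, 0 ≤ K →
          (∀ x w, |ψ (x + torusMk w) - ψ x| ≤ K * ‖w‖) → ∀ s t, s ≤ t →
          |∫ x, ψ x ∂embed (m t) - ∫ x, ψ x ∂embed (m s)|
            ≤ K * ∫ r in Ioc s t, h r ∂timeMeasure a b := by
  obtain ⟨c, K, hc, hK, hcK⟩ := hF.exists_le_energy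
  let Bc : ℝ≥0∞ := ENNReal.ofReal A + ENNReal.ofReal K * (timeMeasure a b univ + M)
  have hBc : Bc ≠ ⊤ := by
    have := measure_ne_top (timeMeasure a b) univ
    simp [Bc, ENNReal.mul_eq_top, this]
  refine ⟨G.maxEdgeLength * (Bc.toReal / c), fun N _ m hact hmass => ?_⟩
  -- The strict inequality yields a competing flux directly, with no need for a minimizer.
  simp only [action, iInf_lt_iff] at hact
  obtain ⟨J, hJ, hJA⟩ := hact
  have hcont := hJ.continuous_mass
  have hcontx : ∀ x, Continuous fun t => (m t x : ℝ) := fun x =>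
    NNReal.continuous_coe.comp ((continuous_apply x).comp hcont)
  have hJm : Measurable fun t => fluxNorm (J t) := by
    unfold fluxNorm
    exact Finset.measurable_sum _ fun e _ =>
      (measurable_pi_iff.1 hJ.measurable_flux e).abs
  have hε : (0 : ℝ) < mesh N := mesh_pos N
  have hg : ∫⁻ t, ENNReal.ofReal (K * (1 + ∑ x, (m t x : ℝ))) ∂timeMeasure a b
      ≤ ENNReal.ofReal K * (timeMeasure a b univ + M) := by
    have : ∀ t, ENNReal.ofReal (K * (1 + ∑ x, (m t x : ℝ)))
        = ENNReal.ofReal K * (1 + ∑ x, (m t x : ℝ≥0∞)) := fun t => by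
      rw [ENNReal.ofReal_mul hK, ENNReal.ofReal_add zero_le_one
        (Finset.sum_nonneg fun _ _ => NNReal.coe_nonneg _), ENNReal.ofReal_one,
        ENNReal.ofReal_sum_of_nonneg fun _ _ => NNReal.coe_nonneg _]
      simp
    simp only [this]
    rw [lintegral_const_mul' _ _ ENNReal.ofReal_ne_top, lintegral_add_left measurable_const,
      lintegral_one]
    gcongr
    exact hmass
  have hflux : ∫⁻ t, ENNReal.ofReal (c * (mesh N * fluxNorm (J t))) ∂timeMeasure a b ≤ Bc := by
    refine (lintegral_le_of_erealIntegral_lt ((hJm.const_mul _).const_mul _)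
      (g := fun t => K * (1 + ∑ x, (m t x : ℝ))) ?_ ?_ ?_
      (fun t => hcK N (m t) (J t)) hJA ?_).trans (add_le_add_right hg _)
    · exact ((continuous_const.add (continuous_finsetSum _ fun x _ => hcontx x)).const_mul
        K).measurable
    · exact fun t => mul_nonneg hc.le (mul_nonneg hε.le (fluxNorm_nonneg _))
    · exact fun t => mul_nonneg hK (add_nonneg zero_le_one
        (Finset.sum_nonneg fun _ _ => NNReal.coe_nonneg _))
    · refine ne_top_of_le_ne_top ?_ hg
      have := measure_ne_top (timeMeasure a b) univ
      simp [ENNReal.mul_eq_top, this]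
  have hcnn : 0 ≤ᵐ[timeMeasure a b] fun t => c * (mesh N * fluxNorm (J t)) :=
    Eventually.of_forall fun t => mul_nonneg hc.le (mul_nonneg hε.le (fluxNorm_nonneg _))
  have hcm : AEStronglyMeasurable (fun t => c * (mesh N * fluxNorm (J t))) (timeMeasure a b) :=
    ((hJm.const_mul _).const_mul _).aestronglyMeasurable
  have hci : Integrable (fun t => c * (mesh N * fluxNorm (J t))) (timeMeasure a b) :=
    (lintegral_ofReal_ne_top_iff_integrable hcm hcnn).1 (ne_top_of_le_ne_top hBc hflux)
  have hfi : Integrable (fun t => mesh N * fluxNorm (J t)) (timeMeasure a b) := by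
    simpa [hc.ne'] using hci.const_mul c⁻¹
  have hni : Integrable (fun t => fluxNorm (J t)) (timeMeasure a b) := by
    simpa [hε.ne'] using hfi.const_mul (mesh N : ℝ)⁻¹
  have hmi : ∀ x, Integrable (fun t => (m t x : ℝ)) (timeMeasure a b) := fun x => by
    refine (lintegral_ofReal_ne_top_iff_integrable (hcontx x).aestronglyMeasurable
      (Eventually.of_forall fun t => NNReal.coe_nonneg _)).1 (ne_top_of_le_ne_top
        (ENNReal.coe_ne_top (r := M)) (le_trans (lintegral_mono fun t => ?_) hmass))
    rw [ENNReal.ofReal_coe_nnreal]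
    exact Finset.single_le_sum (f := fun x => (m t x : ℝ≥0∞)) (fun _ _ => zero_le)
      (Finset.mem_univ x)
  have hdm : ∀ x, AEStronglyMeasurable (fun t => divergence (J t) x) (timeMeasure a b) := fun x => by
    classical
    simp only [divergence_eq_sum]
    refine (Finset.measurable_sum _ fun e _ => ?_).aestronglyMeasurable
    split_ifs
    · exact measurable_pi_iff.1 hJ.measurable_flux e
    · exact measurable_const
  -- The flux bound upgrades local integrability of the divergence to integrability on the whole
  -- interval.
  have hdi : ∀ x, Integrable (fun t => divergence (J t) x) (timeMeasure a b) := fun x =>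
    hni.mono' (hdm x) (Eventually.of_forall fun t => abs_divergence_le (J t) x)
  refine ⟨hcont, fun t => G.maxEdgeLength * (mesh N * fluxNorm (J t)), hfi.const_mul _,
    fun t => mul_nonneg G.maxEdgeLength_nonneg (mul_nonneg hε.le (fluxNorm_nonneg _)), ?_, ?_⟩
  · rw [integral_const_mul]
    refine mul_le_mul_of_nonneg_left ?_ G.maxEdgeLength_nonneg
    rw [le_div_iff₀ hc, mul_comm, ← integral_const_mul, integral_eq_lintegral_of_nonneg_ae hcnn hcm]
    exact ENNReal.toReal_mono hBc hflux
  · intro ψ hψ L hL hψL s t hst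
    rw [integral_embed _ hψ, integral_embed _ hψ, ← integral_const_mul]
    refine abs_sub_le_setIntegral_of_weak (fun t => ∑ x, (m t x : ℝ) * cubeAvg N ψ x.1)
      (fun t => ∑ x : RVertex d N V, cubeAvg N ψ x.1 * divergence (J t) x)
      (fun t => L * (G.maxEdgeLength * (mesh N * fluxNorm (J t))))
      (continuous_finsetSum _ fun x _ => (hcontx x).mul_const _)
      (integrable_finsetSum _ fun x _ => (hmi x).mul_const _)
      (integrable_finsetSum _ fun x _ => (hdi x).const_mul _)
      ((hfi.const_mul _).const_mul _) (fun t => ?_) (fun η hη hηc hηs => ?_) s t hst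
    · refine (abs_sum_mul_divergence_le (J t) (cubeAvg N ψ) fun e he =>
        abs_cubeAvg_edge_sub_le G N hψ hL hψL e he).trans_eq ?_
      ring
    · have hb : ∀ {k : ℝ → ℝ}, Continuous k → HasCompactSupport k → ∀ {f : Ioo a b → ℝ},
          Integrable f (timeMeasure a b) →
          Integrable (fun t : Ioo a b => k t * f t) (timeMeasure a b) := fun hk hkc f hf => by
        obtain ⟨D, hD⟩ := hkc.exists_bound_of_continuous hk
        exact hf.bdd_mul (hk.comp continuous_subtype_val).aestronglyMeasurable
          (Eventually.of_forall fun t => hD t)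
      have hη' : Continuous (deriv η) := hη.continuous_deriv (by simp)
      have e1 : ∫ t : Ioo a b, deriv η t * ∑ x, (m t x : ℝ) * cubeAvg N ψ x.1 ∂timeMeasure a b
          = ∑ x, cubeAvg N ψ x.1 * ∫ t : Ioo a b, deriv η t * (m t x : ℝ) ∂timeMeasure a b := by
        simp only [← integral_const_mul]
        rw [← integral_finsetSum _ fun x _ => (hb hη' hηc.deriv (hmi x)).const_mul _]
        congr 1
        ext t
        rw [Finset.mul_sum]
        exact Finset.sum_congr rfl fun x _ => by ring
      have e2 : ∫ t : Ioo a b, η t * ∑ x : RVertex d N V, cubeAvg N ψ x.1 * divergence (J t) x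
            ∂timeMeasure a b
          = ∑ x : RVertex d N V, cubeAvg N ψ x.1 *
            ∫ t : Ioo a b, η t * divergence (J t) x ∂timeMeasure a b := by
        simp only [← integral_const_mul]
        rw [← integral_finsetSum _ fun x _ => (hb hη.continuous hηc (hdi x)).const_mul _]
        congr 1
        ext t
        rw [Finset.mul_sum]
        exact Finset.sum_congr rfl fun x _ => by ring
      -- The weak equation for the pairing is the combination of the vertex equations with the cube
      -- averages as coefficients.
      rw [e1, e2, ← Finset.sum_neg_distrib, ← Finset.sum_add_distrib]
      refine Finset.sum_eq_zero fun x _ => ?_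
      have := hJ.weak_eq x η hη hηc hηs
      rw [← mul_neg, ← mul_add, this, mul_zero]

end Level

/-! ### Space-time measures -/

section SpaceTime

variable {d : ℕ} {a b : ℝ}

/-- Identification with a kernel composition-product gives access to Fubini for space-time
integrals. -/
theorem spaceTime_eq_compProd {μ : Ioo a b → Measure (Torus d)} (hμ : Measurable μ)
    [ProbabilityTheory.IsFiniteKernel (⟨μ, hμ⟩ : ProbabilityTheory.Kernel (Ioo a b) (Torus d))] :
    spaceTime μ = (timeMeasure a b).compProd ⟨μ, hμ⟩ := by
  set κ : ProbabilityTheory.Kernel (Ioo a b) (Torus d) := ⟨μ, hμ⟩ with hκ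
  have hmap : ∀ t {s : Set (Ioo a b × Torus d)}, MeasurableSet s →
      (μ t).map (Prod.mk t) s = κ t (Prod.mk t ⁻¹' s) := fun t s hs =>
    Measure.map_apply measurable_prodMk_left hs
  have hm : Measurable fun t => (μ t).map (Prod.mk t) := by
    refine Measure.measurable_of_measurable_coe _ fun s hs => ?_
    simp only [hmap _ hs]
    exact ProbabilityTheory.Kernel.measurable_kernel_prodMk_left hs
  ext s hs
  rw [spaceTime, Measure.bind_apply hs hm.aemeasurable, Measure.compProd_apply hs]
  simp only [hmap _ hs]

theorem isFiniteKernel_of_le {μ : Ioo a b → Measure (Torus d)} (hμ : Measurable μ) {C : ℝ≥0}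
    (hC : ∀ t, μ t univ ≤ C) :
    ProbabilityTheory.IsFiniteKernel (⟨μ, hμ⟩ : ProbabilityTheory.Kernel (Ioo a b) (Torus d)) :=
  ⟨⟨C, ENNReal.coe_lt_top, hC⟩⟩

theorem isFiniteMeasure_spaceTime {μ : Ioo a b → Measure (Torus d)} (hμ : Measurable μ) {C : ℝ≥0}
    (hC : ∀ t, μ t univ ≤ C) : IsFiniteMeasure (spaceTime μ) := by
  have := isFiniteKernel_of_le hμ hC
  rw [spaceTime_eq_compProd hμ]
  infer_instance

theorem integral_spaceTime {μ : Ioo a b → Measure (Torus d)} (hμ : Measurable μ) {C : ℝ≥0}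
    (hC : ∀ t, μ t univ ≤ C) (f : BoundedContinuousFunction (Ioo a b × Torus d) ℝ) :
    ∫ p, f p ∂spaceTime μ = ∫ t, ∫ x, f (t, x) ∂μ t ∂timeMeasure a b := by
  have := isFiniteKernel_of_le hμ hC
  rw [spaceTime_eq_compProd hμ, Measure.integral_compProd (f.integrable _)]
  rfl

/-- Dominated convergence in time: the inner integrals converge for a.e. `t` and are bounded by `C
‖f‖`. -/
theorem tendsto_integral_integral {μs : ℕ → Ioo a b → FiniteMeasure (Torus d)}
    {μ : Ioo a b → FiniteMeasure (Torus d)}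
    (hμs : ∀ n, Measurable fun t => (μs n t : Measure (Torus d)))
    {C : ℝ≥0} (hC : ∀ n t, (μs n t : Measure (Torus d)) univ ≤ C)
    (h : ∀ᵐ t ∂timeMeasure a b, Tendsto (fun n => μs n t) atTop (𝓝 (μ t)))
    (f : BoundedContinuousFunction (Ioo a b × Torus d) ℝ) :
    Tendsto (fun n => ∫ t, ∫ x, f (t, x) ∂(μs n t : Measure (Torus d)) ∂timeMeasure a b) atTop
      (𝓝 (∫ t, ∫ x, f (t, x) ∂(μ t : Measure (Torus d)) ∂timeMeasure a b)) := by
  let Φ : Ioo a b → C(Torus d, ℝ) := fun t => ⟨fun x => f (t, x), by fun_prop⟩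
  have hΦ : Continuous Φ := ContinuousMap.continuous_of_continuous_uncurry _ f.continuous
  have hΦn : ∀ t, ‖Φ t‖ ≤ ‖f‖ := fun t =>
    (ContinuousMap.norm_le _ (norm_nonneg _)).2 fun x => f.norm_coe_le_norm (t, x)
  refine tendsto_integral_of_dominated_convergence (fun _ => (C : ℝ) * ‖f‖)
    (fun n => (measurable_integral_curve (hμs n) (hC n) hΦ).aestronglyMeasurable)
    (integrable_const _) (fun n => Eventually.of_forall fun t => ?_) ?_
  · refine (abs_integral_le_norm (μs n t : Measure (Torus d)) (Φ t)).trans ?_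
    have : (μs n t : Measure (Torus d)).real univ ≤ C := ENNReal.toReal_le_coe_of_le_coe (hC n t)
    have h2 := hΦn t
    gcongr
  · filter_upwards [h] with t ht
    exact FiniteMeasure.tendsto_iff_forall_integral_tendsto.1 ht
      (BoundedContinuousFunction.mkOfCompact (Φ t))

theorem weakTendsto_spaceTime {μs : ℕ → Ioo a b → FiniteMeasure (Torus d)}
    {μ : Ioo a b → FiniteMeasure (Torus d)}
    (hμs : ∀ n, Measurable fun t => (μs n t : Measure (Torus d)))
    (hμ : Measurable fun t => (μ t : Measure (Torus d)))
    {C : ℝ≥0} (hC : ∀ n t, (μs n t : Measure (Torus d)) univ ≤ C)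
    (hC' : ∀ t, (μ t : Measure (Torus d)) univ ≤ C)
    (h : ∀ᵐ t ∂timeMeasure a b, Tendsto (fun n => μs n t) atTop (𝓝 (μ t))) :
    WeakTendsto (fun n => spaceTime fun t => (μs n t : Measure (Torus d)))
      (spaceTime fun t => (μ t : Measure (Torus d))) := by
  refine ⟨fun n => isFiniteMeasure_spaceTime (hμs n) (hC n), isFiniteMeasure_spaceTime hμ hC',
    FiniteMeasure.tendsto_iff_forall_integral_tendsto.2 fun f => ?_⟩
  simp only [FiniteMeasure.toMeasure_mk, integral_spaceTime hμ hC', integral_spaceTime (hμs _) (hC _)]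
  exact tendsto_integral_integral hμs hC h f

end SpaceTime

/-! ### Bounded variation -/

/-- Functions in the unit ball of `C¹(𝕋^d)` have a common modulus of continuity. -/
theorem exists_modulus_C1Torus (d : ℕ) : ∃ K : ℝ, 0 ≤ K ∧ ∀ p : C1Torus d, ‖p‖ ≤ 1 →
    ∀ x w, |p.1.1 (x + torusMk w) - p.1.1 x| ≤ K * ‖w‖ := by
  -- Gradients are measured in the Euclidean norm and displacements in the sup norm; `‖T‖` is the
  -- price of the change. The bound itself is the mean value inequality on the lift to `ℝ^d`.
  let T := (EuclideanSpace.equiv (Fin d) ℝ).symm.toContinuousLinearMap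
  refine ⟨‖T‖, norm_nonneg _, fun p hp x w => ?_⟩
  obtain ⟨y, rfl⟩ : ∃ y, torusMk y = x := by
    choose y hy using fun i => QuotientAddGroup.mk_surjective (x i)
    exact ⟨y, funext hy⟩
  let u : EuclideanSpace ℝ (Fin d) → ℝ := fun w' => p.1.1 fun i => (w' i : UnitAddCircle)
  have hgrad : ∀ z ∈ (univ : Set (EuclideanSpace ℝ (Fin d))),
      ‖InnerProductSpace.toDual ℝ (EuclideanSpace ℝ (Fin d))
        (p.1.2 fun i => (z i : UnitAddCircle))‖ ≤ 1 := fun z _ => by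
    rw [LinearIsometryEquiv.norm_map]
    exact (p.1.2.norm_coe_le_norm _).trans ((le_max_right _ _).trans hp)
  have h := convex_univ.norm_image_sub_le_of_norm_hasFDerivWithin_le (f := u)
    (fun z _ => (p.2 z).hasFDerivAt.hasFDerivWithinAt) hgrad (mem_univ (T y)) (mem_univ (T (y + w)))
  rw [map_add, add_sub_cancel_left, one_mul, ← map_add] at h
  exact h.trans (T.le_opNorm w)

theorem hasDerivAt_comp_of_isBoundedLinearMap {E F : Type*} [NormedAddCommGroup E]
    [NormedSpace ℝ E] [NormedAddCommGroup F] [NormedSpace ℝ F] {f : E → F}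
    (hf : IsBoundedLinearMap ℝ f) {φ : ℝ → E} {φ' : E} {t : ℝ} (h : HasDerivAt φ φ' t) :
    HasDerivAt (fun t => f (φ t)) (f φ') t :=
  (hf.hasFDerivAt (x := φ t)).comp_hasDerivAt t h

/-- For a fixed test function the space-time integral is a limit of those along `μs n`, each at most
`2 B` by `integral_deriv_le_of_variation`; the supremum is taken only afterwards. -/
theorem bvSeminorm_le {d : ℕ} {a b : ℝ} {μs : ℕ → Ioo a b → FiniteMeasure (Torus d)}
    {μ : Ioo a b → FiniteMeasure (Torus d)}
    (hμs : ∀ n, Measurable fun t => (μs n t : Measure (Torus d)))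
    {C : ℝ≥0} (hC : ∀ n t, (μs n t : Measure (Torus d)) univ ≤ C)
    (h : ∀ᵐ t ∂timeMeasure a b, Tendsto (fun n => μs n t) atTop (𝓝 (μ t)))
    {v : ℕ → ℝ → ℝ} (hv : ∀ n, Monotone (v n)) {B : ℝ} (hB : ∀ n t, |v n t| ≤ B)
    (hvar : ∀ n (p : C1Torus d), ‖p‖ ≤ 1 → ∀ s t : Ioo a b, s ≤ t →
      |∫ x, p.1.1 x ∂(μs n t : Measure (Torus d)) - ∫ x, p.1.1 x ∂(μs n s : Measure (Torus d))|
        ≤ v n t - v n s) :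
    bvSeminorm (fun t => (μ t : Measure (Torus d))) ≤ ((2 * B : ℝ) : EReal) := by
  refine iSup₂_le fun φ hφ => EReal.coe_le_coe_iff.2 ?_
  obtain ⟨hφ1, hφc, hφs, hφn⟩ := hφ
  have hbdd : IsBoundedLinearMap ℝ fun p : C1Torus d => p.1.1 :=
    IsLinearMap.with_bound ⟨fun _ _ => rfl, fun _ _ => rfl⟩ 1 fun p => by
      rw [one_mul]
      exact le_max_left _ _
  let Φ : ℝ → C(Torus d, ℝ) := fun t => (φ t).1.1
  have hΦ : ContDiff ℝ 1 Φ := 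
    ContDiff.comp (g := fun p : C1Torus d => p.1.1) hbdd.contDiff hφ1
  have hΦc : HasCompactSupport Φ := 
    HasCompactSupport.comp_left (g := fun p : C1Torus d => p.1.1) hφc rfl
  have hΦs : tsupport Φ ⊆ Ioo a b := 
    (tsupport_comp_subset (g := fun p : C1Torus d => p.1.1) rfl φ).trans hφs
  have hder : ∀ t, deriv Φ t = (deriv φ t).1.1 := fun t =>
    (hasDerivAt_comp_of_isBoundedLinearMap hbdd
      (hφ1.differentiable (by simp) t).hasDerivAt).deriv
  have hdc : Continuous (deriv Φ) := hΦ.continuous_deriv le_rfl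
  obtain ⟨D, hD⟩ := hΦc.deriv.exists_bound_of_continuous hdc
  let f : BoundedContinuousFunction (Ioo a b × Torus d) ℝ :=
    BoundedContinuousFunction.ofNormedAddCommGroup (fun p => deriv Φ p.1 p.2) (by fun_prop) D
      fun p => ((deriv Φ p.1).norm_coe_le_norm p.2).trans (hD _)
  have hlim := tendsto_integral_integral hμs hC h f
  have hlhs : ∫ t : Ioo a b, ∫ x, (deriv φ t).1.1 x ∂(μ t : Measure (Torus d)) ∂timeMeasure a b
      = ∫ t, ∫ x, f (t, x) ∂(μ t : Measure (Torus d)) ∂timeMeasure a b := by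
    congr 1
    ext t
    change _ = ∫ x, deriv Φ t x ∂(μ t : Measure (Torus d))
    rw [hder]
  rw [hlhs]
  refine le_of_tendsto' hlim fun n => ?_
  let ν : ℝ → Measure (Torus d) := Function.extend Subtype.val (fun t => (μs n t : Measure _)) 0
  have hν : ∀ t : Ioo a b, ν t = μs n t := fun t => Subtype.val_injective.extend_apply _ _ t
  have hν0 : ∀ t ∉ Ioo a b, ν t = 0 := fun t ht =>
    Function.extend_apply' _ _ _ fun ⟨s, hs⟩ => ht (hs ▸ s.2)
  have hνm : Measurable ν := (MeasurableEmbedding.subtype_coe measurableSet_Ioo).measurable_extend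
    (hμs n) measurable_zero
  have hνC : ∀ t, ν t univ ≤ C := fun t => by
    by_cases ht : t ∈ Ioo a b
    · exact (hν ⟨t, ht⟩).symm ▸ hC n ⟨t, ht⟩
    · simp [hν0 t ht]
  have hmain := integral_deriv_le_of_variation hνm hνC hν0 hΦ hΦc hΦs (hv n) (hB n)
    fun r s hs t ht hst => by
      rw [hν ⟨s, hs⟩, hν ⟨t, ht⟩]
      exact hvar n (φ r) (hφn r) ⟨s, hs⟩ ⟨t, ht⟩ hst
  refine le_trans (le_of_eq ?_) hmain
  rw [← setIntegral_eq_integral_of_forall_compl_eq_zero (s := Ioo a b)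
    (fun t ht => by rw [hν0 t ht, integral_zero_measure]), ← integral_subtype_comap measurableSet_Ioo]
  simp only [hν]
  rfl

theorem LipschitzWith.abs_add_torusMk_sub_le {d : ℕ} {f : Torus d → ℝ} {L : ℝ≥0}
    (hf : LipschitzWith L f) (x : Torus d) (w : Fin d → ℝ) :
    |f (x + torusMk w) - f x| ≤ L * ‖w‖ := by
  refine (hf.dist_le_mul (x + torusMk w) x).trans ?_
  rw [dist_eq_norm, add_sub_cancel_left]
  gcongr
  exact norm_torusMk_le w

theorem measurable_embed {d : ℕ} {V : Type*} [Fintype V] {N : ℕ} [NeZero N] {α : Type*}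
    [MeasurableSpace α] {m : α → RVertex d N V → ℝ≥0} (hm : Measurable m) :
    Measurable fun t => embed (m t) := by
  refine measurable_of_measurable_integral fun f => ?_
  simp only [integral_embed _ f.continuous]
  exact Finset.measurable_sum _ fun x _ =>
    ((measurable_pi_iff.1 hm x).coe_nnreal_real).mul_const _

theorem timeMeasure_univ (a b : ℝ) : timeMeasure a b univ = ENNReal.ofReal (b - a) := by
  rw [timeMeasure, comap_subtype_coe_apply measurableSet_Ioo, image_univ, Subtype.range_coe,
    Real.volume_Ioo]

theorem timeMeasure_eq_zero_of_countable {a b : ℝ} {S : Set (Ioo a b)} (hS : S.Countable) :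
    timeMeasure a b S = 0 := by
  rw [timeMeasure, comap_subtype_coe_apply measurableSet_Ioo]
  exact (hS.image _).measure_zero _

/-- The primitive of a nonnegative function on an interval. -/
noncomputable def cumulative {a b : ℝ} (h : Ioo a b → ℝ) (t : ℝ) : ℝ :=
  ∫ r in {r | (r : ℝ) ≤ t}, h r ∂timeMeasure a b

/-! ### Monotone variation functions on the whole line -/

section Cumulative

variable {a b : ℝ} {h : Ioo a b → ℝ}

theorem monotone_cumulative (hi : Integrable h (timeMeasure a b)) (h0 : ∀ t, 0 ≤ h t) :
    Monotone (cumulative h) := fun _ _ hst =>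
  setIntegral_mono_set hi.integrableOn (Eventually.of_forall h0)
    (Eventually.of_forall fun _ hr => le_trans hr hst)

theorem abs_cumulative_le (hi : Integrable h (timeMeasure a b)) (h0 : ∀ t, 0 ≤ h t) (t : ℝ) :
    |cumulative h t| ≤ ∫ r, h r ∂timeMeasure a b := by
  rw [cumulative, abs_of_nonneg (integral_nonneg h0)]
  exact setIntegral_le_integral hi (Eventually.of_forall h0)

theorem setIntegral_Ioc_eq_cumulative_sub (hi : Integrable h (timeMeasure a b)) {s t : Ioo a b}
    (hst : s ≤ t) : ∫ r in Ioc s t, h r ∂timeMeasure a b = cumulative h t - cumulative h s := by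
  have hu : ({r | (r : ℝ) ≤ t} : Set (Ioo a b)) =
      ({r | (r : ℝ) ≤ s} : Set (Ioo a b)) ∪ Ioc s t :=
    (Iic_union_Ioc_eq_Iic hst).symm
  have hd : Disjoint ({r | (r : ℝ) ≤ s} : Set (Ioo a b)) (Ioc s t) :=
    disjoint_left.2 fun r hr hr' => absurd hr'.1 (not_lt.2 hr)
  rw [cumulative, cumulative, hu, setIntegral_union hd measurableSet_Ioc hi.integrableOn
    hi.integrableOn, add_sub_cancel_left]

end Cumulative

/-- At exceptional times the curve takes its value from one fixed good time `t₀`. This keeps it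
measurable and makes the mass constant at every time, not just almost every time. -/
theorem exists_countable_compl_limit_curve {X : Type*} [MetricSpace X] [CompactSpace X]
    [MeasurableSpace X] [BorelSpace X] {a b : ℝ} (hab : a < b) (μs : ℕ → Ioo a b → FiniteMeasure X)
    (hμs : ∀ k, Measurable fun t => (μs k t : Measure X)) {C : ℝ≥0}
    (hC : ∀ k t, (μs k t : Measure X) univ ≤ C)
    (hconst : ∀ k s t, (μs k s : Measure X) univ = (μs k t : Measure X) univ)
    {S : Set (Ioo a b)} (hS : S.Countable)
    (hlim : ∀ t ∉ S, ∃ ν, Tendsto (fun k => μs k t) atTop (𝓝 ν)) :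
    ∃ μ : Ioo a b → FiniteMeasure X, (Measurable fun t => (μ t : Measure X)) ∧
      (∀ t, (μ t : Measure X) univ ≤ C) ∧
      (∀ s t, (μ s : Measure X) univ = (μ t : Measure X) univ) ∧
      ∀ᵐ t ∂timeMeasure a b, Tendsto (fun k => μs k t) atTop (𝓝 (μ t)) := by
  have hSae : ∀ᵐ t ∂timeMeasure a b, t ∉ S :=
    measure_eq_zero_iff_ae_notMem.1 (timeMeasure_eq_zero_of_countable hS)
  obtain ⟨t₀, ht₀⟩ : ∃ t₀, t₀ ∉ S := by
    have : NeZero (timeMeasure a b) := ⟨fun h => by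
      have := timeMeasure_univ a b
      rw [h] at this
      simp at this
      exact absurd hab (not_lt.2 this)⟩
    exact hSae.exists
  classical
  let sel : Ioo a b → Ioo a b := fun t => if t ∈ S then t₀ else t
  have hselm : Measurable sel := Measurable.ite hS.measurableSet measurable_const measurable_id
  have hselS : ∀ t, sel t ∉ S := fun t => by
    by_cases ht : t ∈ S <;> simp [sel, ht, ht₀]
  choose μ hμ using fun t => hlim (sel t) (hselS t)
  refine ⟨μ, ?_, fun t => ?_, fun s t => ?_, ?_⟩
  · refine measurable_of_measurable_integral fun f => ?_
    refine measurable_of_tendsto_metrizable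
      (f := fun k t => ∫ x, f x ∂(μs k (sel t) : Measure X)) (fun k => ?_) ?_
    · exact (measurable_integral_curve (hμs k) (hC k) (continuous_const (y := f))).comp hselm
    · exact tendsto_pi_nhds.2 fun t => FiniteMeasure.tendsto_iff_forall_integral_tendsto.1 (hμ t)
        (BoundedContinuousFunction.mkOfCompact f)
  · rw [← FiniteMeasure.ennreal_mass, ENNReal.coe_le_coe]
    refine le_of_tendsto' (hμ t).mass fun k => ?_
    rw [← ENNReal.coe_le_coe, FiniteMeasure.ennreal_mass]
    exact hC _ _
  · rw [← FiniteMeasure.ennreal_mass, ← FiniteMeasure.ennreal_mass, ENNReal.coe_inj]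
    refine tendsto_nhds_unique (hμ s).mass ((hμ t).mass.congr fun k => ?_)
    rw [← ENNReal.coe_inj, FiniteMeasure.ennreal_mass, FiniteMeasure.ennreal_mass]
    exact hconst _ _ _
  · filter_upwards [hSae] with t ht
    have hst : sel t = t := by simp [sel, ht]
    simpa only [hst] using hμ t

end PeriodicTransport

open PeriodicTransport

/-! ### The compactness theorem -/

theorem mainTheorem2 {d : ℕ} {V : Type*} [Fintype V] (G : PeriodicGraph d V)
    (F : (Vertex d V → ℝ≥0) × Flux G.edges → EReal) (hF : AdmissibleCost G F)
    (a b : ℝ) (hab : a < b)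
    (N : ℕ → ℕ) [∀ k, NeZero (N k)] (hN : Tendsto N atTop atTop)
    (hNR : ∀ k, (mesh (N k) : ℝ) * G.maxEdgeLength < 1 / 2)
    (m : ∀ k, Ioo a b → RVertex d (N k) V → ℝ≥0)
    (hA : (⨆ k, action G F (N k) a b (m k)) < ⊤)
    (hM : (⨆ k, totalMass (N k) a b (m k)) < ⊤) :
    ∃ (μ : Ioo a b → Measure (Torus d)) (φ : ℕ → ℕ),
      MemBVKR μ ∧ StrictMono φ ∧
      WeakTendsto (fun k => spaceTime fun t => embed (m (φ k) t)) (spaceTime μ) ∧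
      (∀ᵐ t ∂timeMeasure a b, WeakTendsto (fun k => embed (m (φ k) t)) (μ t)) ∧
      ∀ s t, μ s univ = μ t univ := by
  obtain ⟨A, hA, -⟩ := EReal.lt_iff_exists_real_btwn.1 hA
  obtain ⟨M, hMM⟩ := ENNReal.lt_iff_exists_nnreal_btwn.1 hM
  obtain ⟨B, hB⟩ := hF.exists_variation_bound a b A M
  have hlev := fun k => hB (N k) (m k) ((le_iSup (fun k => action G F (N k) a b (m k)) k).trans_lt hA)
    ((le_iSup (fun k => totalMass (N k) a b (m k)) k).trans hMM.1.le)
  choose hcont h hi h0 hhB hvar using hlev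
  let μs : ℕ → Ioo a b → FiniteMeasure (Torus d) := fun k t => ⟨embed (m k t), inferInstance⟩
  have hμsm : ∀ k, Measurable fun t => (μs k t : Measure (Torus d)) := fun k =>
    measurable_embed (hcont k).measurable
  have hconst : ∀ k s t, (μs k s : Measure (Torus d)) univ = (μs k t : Measure (Torus d)) univ := by
    have hle : ∀ k s t, s ≤ t →
        (μs k s : Measure (Torus d)) univ = (μs k t : Measure (Torus d)) univ := by
      intro k s t hst
      -- Conservation of mass: the constant function has modulus `0`.
      have := hvar k (fun _ => 1) continuous_const 0 le_rfl (by simp) s t hst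
      rw [zero_mul] at this
      have := sub_eq_zero.1 (abs_nonpos_iff.1 this)
      simp only [integral_const, smul_eq_mul, mul_one] at this
      exact ((measureReal_eq_measureReal_iff (μ := embed (m k t)) (ν := embed (m k s))).1 this).symm
    intro k s t
    rcases le_total s t with hst | hst
    · exact hle k s t hst
    · exact (hle k t s hst).symm
  -- As the mass is constant in time, the space-time mass is the mass at any time multiplied by `b -
  -- a`.
  let C : ℝ≥0 := M / (b - a).toNNReal
  have hC : ∀ k t, (μs k t : Measure (Torus d)) univ ≤ C := by
    intro k t
    have h1 : totalMass (N k) a b (m k) = (μs k t : Measure (Torus d)) univ * (b - a).toNNReal := by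
      have : ∀ r, ∑ x, (m k r x : ℝ≥0∞) = (μs k t : Measure (Torus d)) univ := fun r => by
        rw [← embed_apply_univ]
        exact hconst k r t
      simp only [totalMass, this, lintegral_const, timeMeasure_univ]
      rfl
    have h2 := (le_iSup (fun k => totalMass (N k) a b (m k)) k).trans hMM.1.le
    have hpos : 0 < (b - a).toNNReal := Real.toNNReal_pos.2 (sub_pos.2 hab)
    rw [ENNReal.coe_div hpos.ne', ENNReal.le_div_iff_mul_le (Or.inl (by exact_mod_cast hpos.ne'))
      (Or.inl ENNReal.coe_ne_top), ← h1]
    exact h2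
  let v : ℕ → ℝ → ℝ := fun k => cumulative (h k)
  have hv : ∀ k, Monotone (v k) := fun k => monotone_cumulative (hi k) (h0 k)
  have hvB : ∀ k t, |v k t| ≤ B := fun k t =>
    (abs_cumulative_le (hi k) (h0 k) t).trans (hhB k)
  have hvar' : ∀ k (ψ : Torus d → ℝ), Continuous ψ → ∀ K : ℝ, 0 ≤ K →
      (∀ x w, |ψ (x + torusMk w) - ψ x| ≤ K * ‖w‖) → ∀ s t : Ioo a b, s ≤ t →
      |∫ x, ψ x ∂(μs k t : Measure (Torus d)) - ∫ x, ψ x ∂(μs k s : Measure (Torus d))|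
        ≤ K * (v k t - v k s) := fun k ψ hψ K hK hψK s t hst => by
    rw [← setIntegral_Ioc_eq_cumulative_sub (hi k) hst]
    exact hvar k ψ hψ K hK hψK s t hst
  obtain ⟨φ, hφ, S, hS, hlim⟩ := exists_subseq_tendsto_of_variation μs C
    (fun k t => ENNReal.coe_le_coe.1 ((FiniteMeasure.ennreal_mass (μ := μs k t)).trans_le (hC k t)))
    v hv B hvB fun k f L hf s t hst =>
      hvar' k f hf.continuous L L.2 (LipschitzWith.abs_add_torusMk_sub_le hf) s t hst
  obtain ⟨μ, hμm, hμC, hmass, hμae⟩ := exists_countable_compl_limit_curve hab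
    (fun k => μs (φ k)) (fun k => hμsm (φ k)) (fun k => hC (φ k)) (fun k => hconst (φ k)) hS hlim
  obtain ⟨K, hK, hKC⟩ := exists_modulus_C1Torus d
  have hbv : bvSeminorm (fun t => (μ t : Measure (Torus d))) ≤ ((2 * (K * B) : ℝ) : EReal) := by
    refine bvSeminorm_le (μs := fun k => μs (φ k)) (fun k => hμsm (φ k)) (fun k => hC (φ k)) hμae
      (v := fun k t => K * v (φ k) t)
      (fun k s t hst => mul_le_mul_of_nonneg_left (hv (φ k) hst) hK) (fun k t => ?_)
      fun k p hp s t hst => ?_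
    · rw [abs_mul, abs_of_nonneg hK]
      exact mul_le_mul_of_nonneg_left (hvB _ _) hK
    · rw [← mul_sub]
      exact hvar' (φ k) p.1.1 p.1.1.continuous K hK (hKC p hp) s t hst
  have hweak := weakTendsto_spaceTime (μs := fun k => μs (φ k)) (fun k => hμsm (φ k)) hμm
    (fun k => hC (φ k)) hμC hμae
  have hfin : ∫⁻ t, (μ t : Measure (Torus d)) univ ∂timeMeasure a b < ⊤ := by
    refine (lintegral_mono hμC).trans_lt ?_
    rw [lintegral_const]
    exact ENNReal.mul_lt_top ENNReal.coe_lt_top (measure_lt_top _ _)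
  have hpt : ∀ᵐ t ∂timeMeasure a b,
      WeakTendsto (fun k => (μs (φ k) t : Measure (Torus d))) (μ t : Measure (Torus d)) := by
    filter_upwards [hμae] with t ht
    exact ⟨fun k => inferInstance, inferInstance, ht⟩
  exact ⟨fun t => μ t, φ, ⟨fun t => inferInstance, hμm, hfin, hbv.trans_lt (EReal.coe_lt_top _)⟩,
    hφ, hweak, hpt, hmass⟩
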